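/- For $d\in\mathbb N=\{1,2,\dots\}$ let $\Omega=\{x\in\mathbb R^d:\|x\|_2\le 1\}$. *Ridge classes.* For $0<\alpha<\infty$ let $s$ be the largest integer strictly less than $\alpha$ and $\beta=\alpha-s\in(0,1]$, and for $g\in C^s[-1,1]$ put $$\|g\|_{\mathrm{Lip}_\alpha}=\max\Big\{\max_{k\le s}\|g^{(k)}\|_\infty,\ \sup_{x\ne y}\frac{|g^{(s)}(x)-g^{(s)}(y)|}{2\min\{1,|x-y|\}^{\beta}}\Big\};$$ for $\alpha=\infty$ and $g\in C^\infty[-1,1]$ put $\|g\|_{C^\infty}=\sup_{k\ge 0}\|g^{(k)}\|_\infty$. For $0<p\le 2$ let $\mathcal R_d^{\alpha,p}$ be the set of all $f:\Omega\to\mathbb R$ of the form $f(x)=g(a\cdot x)$ with $\|g\|_{\mathrm{Lip}_\alpha}\le 1$ (with $\|g\|_{C^\infty}\le 1$ if $\alpha=\infty$) and $\|a\|_p=(\sum_i|a_i|^p)^{1/p}\le 1$. For $\alpha>1$ and $\kappa>0$ let $\mathcal R_d^{\alpha,p,\kappa}$ be the set of all such $f$ with, in addition, $|g'(0)|\ge\kappa$.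 *Information complexity.* An algorithm using $m$ function values evaluates $f$ at points $x_1,\dots,x_m\in\Omega$, where $x_i$ may depend on $f(x_1),\dots,f(x_{i-1})$, and outputs $S(f)=\varphi(f(x_1),\dots,f(x_m))$, where $\varphi:\mathbb R^m\to L_\infty(\Omega)$ is any map with $\varphi(0)=0$. For a family of classes $\mathcal F=(\mathcal F_d)_{d\in\mathbb N}$ of functions on $\Omega$, and $0<\varepsilon\le 1$, let $n(\varepsilon,d)$ be the least $n\in\mathbb N$ such that $\inf_S\sup_{f\in\mathcal F_d}\|f-S(f)\|_\infty\le\varepsilon$, the infimum being over all algorithms that use $m\le n$ function values ($n(\varepsilon,d)=\infty$ if there is no such $n$). *Tractability.* The problem of sampling $\mathcal F$ - is polynomially tractable if there are $c,r,q>0$ with $n(\varepsilon,d)\le c\,\varepsilon^{-r}d^{\,q}$ for all $0<\varepsilon<1$ and $d\in\mathbb N$; - is quasi-polynomially tractable if there are $C,t>0$ with $n(\varepsilon,d)\le C\exp\big(t(1+\ln(1/\varepsilon))(1+\ln d)\big)$ for all $0<\varepsilon\le 1$ and $d\in\mathbb N$; - is weakly tractable if $\lim_{1/\varepsilon+d\to\infty}\frac{\log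 n(\varepsilon,d)}{1/\varepsilon+d}=0$ (over $0<\varepsilon\le1$, $d\in\mathbb N$), and intractable if it is not weakly tractable; - suffers from the curse of dimensionality if there are $c,\gamma>0$ and $0<\varepsilon_0\le 1$ such that for all $0<\varepsilon\le\varepsilon_0$ one has $n(\varepsilon,d)\ge c(1+\gamma)^d$ for infinitely many $d\in\mathbb N$. **Theorem.** Let $0<\alpha\le\infty$ and $0<p\le 2$. Sampling of ridge functions in the classes $\mathcal R_d^{\alpha,p}$, $d\in\mathbb N$, 1. suffers from the curse of dimensionality if $p=2$ and $\alpha<\infty$; 2. does not suffer from the curse of dimensionality if $p<2$; 3. is intractable if $p<2$ and $\alpha\le\frac{1}{1/p-1/2}$; 4. is weakly tractable if $p<2$ and $\alpha>\frac{1}{1/\max\{1,p\}-1/2}$; 5. is quasi-polynomially tractable if $\alpha=\infty$. 6. If $\alpha>1$ and $\kappa>0$, then sampling of ridge functions in the classes $\mathcal R_d^{\alpha,p,\kappa}$, $d\in\mathbb N$, is polynomially tractable. -/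

import Mathlib

open MeasureTheory Filter Topology
open scoped ENNReal

noncomputable section

/-- The closed Euclidean unit ball of `ℝ^d`, as a type. -/
abbrev UnitBall (d : ℕ) : Type := Metric.closedBall (0 : EuclideanSpace ℝ (Fin d)) 1

/-- Lebesgue measure on the closed unit ball. -/
def ballMeasure (d : ℕ) : Measure (UnitBall d) :=
  (volume : Measure (EuclideanSpace ℝ (Fin d))).comap Subtype.val

/-- The interval `[-1,1]`, the domain of the profiles. -/
def profileInterval : Set ℝ := Set.Icc (-1) 1

/-- The norm of `C^s[-1,1]`: the maximum of `sup |g^(k)|` over `k ≤ s`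
(derivatives at the end points are one-sided). -/
def csNorm (s : ℕ) (g : ℝ → ℝ) : ℝ≥0∞ :=
  ⨆ k : ℕ, ⨆ _ : k ≤ s, ⨆ t ∈ profileInterval, ‖iteratedDerivWithin k g profileInterval t‖ₑ

/-- The norm of `C^∞[-1,1]`: the supremum of `sup |g^(k)|` over all `k`. -/
def smoothNorm (g : ℝ → ℝ) : ℝ≥0∞ :=
  ⨆ k : ℕ, ⨆ t ∈ profileInterval, ‖iteratedDerivWithin k g profileInterval t‖ₑ

/-- The Hölder constant of order `β` on `[-1,1]`, normalised as
`sup |g x - g y| / (2 min {1, |x - y|} ^ β)`. -/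
def holderConst (β : ℝ) (g : ℝ → ℝ) : ℝ≥0∞ :=
  ⨆ x ∈ profileInterval, ⨆ y ∈ profileInterval, ⨆ _ : x ≠ y,
    ENNReal.ofReal (|g x - g y| / (2 * (min 1 |x - y|) ^ β))

/-- The largest integer strictly less than `α`, for `α > 0`. -/
def strictFloor (α : ℝ) : ℕ := ⌈α⌉₊ - 1

/-- The norm of the Lipschitz space of order `α` on `[-1,1]`. -/
def lipNorm (α : ℝ) (g : ℝ → ℝ) : ℝ≥0∞ :=
  max (csNorm (strictFloor α) g)
    (holderConst (α - strictFloor α)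
      (iteratedDerivWithin (strictFloor α) g profileInterval))

/-- `g` restricted to `[-1,1]` lies in the closed unit ball of the Lipschitz space of
order `α` if `α < ∞`, and in that of `C^∞[-1,1]` if `α = ∞`. -/
def InProfileBall (α : ℝ≥0∞) (g : ℝ → ℝ) : Prop :=
  if α = ⊤ then
    ContDiffOn ℝ ((⊤ : ℕ∞) : WithTop ℕ∞) g profileInterval ∧ smoothNorm g ≤ 1
  else
    ContDiffOn ℝ ((strictFloor α.toReal : ℕ∞) : WithTop ℕ∞) g profileInterval ∧
      lipNorm α.toReal g ≤ 1

/-- The `ℓ_p`-(quasi-)norm on `ℝ^d`, for `0 < p < ∞`. -/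
def lpQuasiNorm {d : ℕ} (p : ℝ) (a : EuclideanSpace ℝ (Fin d)) : ℝ :=
  (∑ i, |a i| ^ p) ^ (1 / p)

/-- The ridge functions `x ↦ g (a ⋅ x)` on the unit ball, with profile `g` in the unit ball
of smoothness `α ∈ (0,∞]` and direction `a` in the unit ball of `ℓ_p^d`. -/
def ridgeClass (α : ℝ≥0∞) (p : ℝ) (d : ℕ) : Set (UnitBall d → ℝ) :=
  {f | ∃ (g : ℝ → ℝ) (a : EuclideanSpace ℝ (Fin d)),
    InProfileBall α g ∧ lpQuasiNorm p a ≤ 1 ∧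
      ∀ x : UnitBall d, f x = g (inner ℝ a (x : EuclideanSpace ℝ (Fin d)))}

/-- The ridge functions of `ridgeClass α p d` with `|g'(0)| ≥ κ` (used for `α > 1`). -/
def ridgeClassDeriv (α : ℝ≥0∞) (p κ : ℝ) (d : ℕ) : Set (UnitBall d → ℝ) :=
  {f | ∃ (g : ℝ → ℝ) (a : EuclideanSpace ℝ (Fin d)),
    InProfileBall α g ∧ lpQuasiNorm p a ≤ 1 ∧ κ ≤ |deriv g 0| ∧
      ∀ x : UnitBall d, f x = g (inner ℝ a (x : EuclideanSpace ℝ (Fin d)))}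

/-- A deterministic adaptive sampling algorithm using exactly `m` function values: the next
sampling point is a function of the values seen so far, and the reconstruction map sends the
vector of values to an element of `L_∞` of the unit ball, and `0` to `0`. -/
structure SamplingAlgorithm (d m : ℕ) where
  point : (k : ℕ) → (Fin k → ℝ) → UnitBall d
  reconstruct : (Fin m → ℝ) → Lp ℝ ⊤ (ballMeasure d)
  reconstruct_zero : reconstruct 0 = 0

/-- The first `k` function values of `f` seen when the sampling points are chosen by `point`. -/
def sampleValues {d : ℕ} (point : (k : ℕ) → (Fin k → ℝ) → UnitBall d) (f : UnitBall d → ℝ) :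
    (k : ℕ) → Fin k → ℝ
  | 0 => Fin.elim0
  | k + 1 => Fin.snoc (α := fun _ => ℝ) (sampleValues point f k)
      (f (point k (sampleValues point f k)))

/-- The output of the algorithm for the input `f`. -/
def SamplingAlgorithm.output {d m : ℕ} (S : SamplingAlgorithm d m) (f : UnitBall d → ℝ) :
    Lp ℝ ⊤ (ballMeasure d) :=
  S.reconstruct (sampleValues S.point f m)

/-- The worst-case `L_∞`-error of an algorithm over the class `F`. -/
def SamplingAlgorithm.worstCaseError {d m : ℕ} (S : SamplingAlgorithm d m)
    (F : Set (UnitBall d → ℝ)) : ℝ≥0∞ :=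
  ⨆ f ∈ F, eLpNorm (fun x => f x - S.output f x) ⊤ (ballMeasure d)

/-- The `n`-th adaptive sampling number of the class `F`. -/
def samplingNumber {d : ℕ} (F : Set (UnitBall d → ℝ)) (n : ℕ) : ℝ≥0∞ :=
  ⨅ m : ℕ, ⨅ _ : m ≤ n, ⨅ S : SamplingAlgorithm d m, S.worstCaseError F

/-- The information complexity `n(ε,d)` of the problem given by the classes `F d`: the least
positive integer `n` whose sampling number is at most `ε` (and `⊤` if there is none). -/
def infoComplexity (F : (d : ℕ) → Set (UnitBall d → ℝ)) (ε : ℝ) (d : ℕ) : ℕ∞ :=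
  ⨅ n : ℕ, ⨅ _ : 1 ≤ n ∧ samplingNumber (F d) n ≤ ENNReal.ofReal ε, (n : ℕ∞)

/-- `n(ε,d) ≤ c ε^(-r) d^q` for all `0 < ε < 1` and all `d ≥ 1`. -/
def PolynomiallyTractable (N : ℝ → ℕ → ℕ∞) : Prop :=
  ∃ c r q : ℝ, 0 < c ∧ 0 < r ∧ 0 < q ∧
    ∀ ε : ℝ, 0 < ε → ε < 1 → ∀ d : ℕ, 1 ≤ d →
      (N ε d : ℝ≥0∞) ≤ ENNReal.ofReal (c * ε ^ (-r) * (d : ℝ) ^ q)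

/-- `n(ε,d) ≤ C exp (t (1 + ln (1/ε)) (1 + ln d))` for all `0 < ε ≤ 1` and all `d ≥ 1`. -/
def QuasiPolynomiallyTractable (N : ℝ → ℕ → ℕ∞) : Prop :=
  ∃ C t : ℝ, 0 < C ∧ 0 < t ∧
    ∀ ε : ℝ, 0 < ε → ε ≤ 1 → ∀ d : ℕ, 1 ≤ d →
      (N ε d : ℝ≥0∞) ≤
        ENNReal.ofReal (C * Real.exp (t * (1 + Real.log (1 / ε)) * (1 + Real.log d)))

/-- `log n(ε,d) / (1/ε + d)` tends to `0` as `1/ε + d → ∞`, where `0 < ε ≤ 1` and `d ≥ 1`.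
The logarithm takes values in the extended reals, so that `log ⊤ = ⊤`. -/
def WeaklyTractable (N : ℝ → ℕ → ℕ∞) : Prop :=
  Tendsto
    (fun z : ℝ × ℕ => ENNReal.log (N z.1 z.2 : ℝ≥0∞) / ((1 / z.1 + (z.2 : ℝ) : ℝ) : EReal))
    (comap (fun z : ℝ × ℕ => 1 / z.1 + (z.2 : ℝ)) atTop ⊓
      𝓟 {z : ℝ × ℕ | 0 < z.1 ∧ z.1 ≤ 1 ∧ 1 ≤ z.2})
    (𝓝 0)

/-- Intractable means not weakly tractable. -/
def Intractable (N : ℝ → ℕ → ℕ∞) : Prop := ¬ WeaklyTractable N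

/-- `n(ε,d) ≥ c (1 + γ)^d` for all `0 < ε ≤ ε₀` and infinitely many `d`. -/
def CurseOfDimensionality (N : ℝ → ℕ → ℕ∞) : Prop :=
  ∃ c ε₀ γ : ℝ, 0 < c ∧ 0 < ε₀ ∧ ε₀ ≤ 1 ∧ 0 < γ ∧
    ∀ ε : ℝ, 0 < ε → ε ≤ ε₀ →
      ∃ᶠ d : ℕ in atTop, ENNReal.ofReal (c * (1 + γ) ^ d) ≤ (N ε d : ℝ≥0∞)

end

/-!
Tractability of sampling ridge functions `x ↦ g (a ⋅ x)` on the Euclidean unit ball.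

*Upper bounds.* For an upper bound it is enough to exhibit information under which any two
functions of the class with the same values are `ε`-close: the algorithm may then return any
function of the class that is consistent with the data (`samplingNumber_le_of_information`).
Suppose that two ridge functions agree at the points `x₀ + y`, where `y` is a sum of `s` vectors
from `{0, h e_1, …, h e_d}`. By the mean value theorem for mixed differences
(`exists_mixedDiff_eq`) their mixed partial derivatives at `x₀` up to order `s` are close, and as
`h → 0` arbitrarily close, because function values are exact. So the two functions nearly share
their Taylor polynomial at `x₀`, and their distance at `x` is at most a multiple of `τ ^ (s + β) /
s!`, where `τ` bounds `|a ⋅ (x - x₀)|` (`abs_ridge_sub_le_of_agree`). At the price of `(d + 1) ^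
s` values per centre, the problem is reduced to the choice of centres.

- For `α = ∞` the single centre `0` suffices, with `s` of order `log (1 / ε)`. This is
  quasi-polynomial tractability.
- For directions in `ℓ_r`, `1 ≤ r < 2`, the centres are obtained by rounding towards zero on a
  grid of width `δ`. The rounding error `y` satisfies `‖y‖_∞ ≤ δ` and `‖y‖_2 ≤ 1`, so
  interpolation and Hölder's inequality give `|a ⋅ y| ≤ δ ^ (2 / r - 1)` (`abs_sum_mul_le_rpow`).
  The rounded points use at most `δ⁻²` grid steps, so there are at most `(2 d + 1) ^ (δ⁻²)` of
  them. With the optimal `δ` this gives `log n(ε, d) ≲ ε ^ (-θ) log d`, where `θ = 1 / (α (1 / r -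
  1 / 2))`. For fixed `ε` the bound is polynomial in `d`, which excludes the curse of
  dimensionality, and for `θ < 1` it yields weak tractability.
- If `|g' 0| ≥ κ`, first differences at the origin reveal the direction of `a`, and equidistant
  points on the line in that direction recover `g`. The second stage depends on the first, so this
  algorithm is adaptive, and it uses `O(d + 1 / ε)` values
  (`infoComplexity_holderRidgeClassDeriv_le`).

*Lower bounds.* A binary code of size exponential in `d` (`exists_binary_code`) gives sign vectors
of `ℓ_p`-norm one and Euclidean norm `R = d ^ (1 / 2 - 1 / p)`. A bump profile near `R` of height
`c R ^ α` turns them into ridge functions supported on disjoint caps of the ball. A sampling point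
sees at most one of them, so exponentially many points are needed to tell all of them from zero
(`exists_le_infoComplexity_ridgeClass`). For `p = 2` the height is constant, which is the curse of
dimensionality; if `α (1 / p - 1 / 2) ≤ 1` it is at least `c / d`, which rules out weak
tractability.
-/

/-! ### Profiles -/

/-- The properties of a profile of smoothness `s + β` used for upper bounds: all derivatives up to
order `s` are bounded by one on `[-1,1]`, and the last one is `β`-Hölder with constant two. -/
structure IsHolderProfile (s : ℕ) (β : ℝ) (g : ℝ → ℝ) : Prop where
  contDiffOn : ContDiffOn ℝ s g profileInterval
  abs_le : ∀ k ≤ s, ∀ t ∈ profileInterval, |iteratedDerivWithin k g profileInterval t| ≤ 1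
  holder : ∀ x ∈ profileInterval, ∀ y ∈ profileInterval,
    |iteratedDerivWithin s g profileInterval x - iteratedDerivWithin s g profileInterval y| ≤
      2 * |x - y| ^ β

theorem uniqueDiffOn_profileInterval : UniqueDiffOn ℝ profileInterval :=
  uniqueDiffOn_Icc (by norm_num)

theorem mem_profileInterval {t : ℝ} : t ∈ profileInterval ↔ |t| ≤ 1 := by
  rw [profileInterval, Set.mem_Icc, abs_le]

theorem convex_profileInterval : Convex ℝ profileInterval := convex_Icc _ _

theorem hasDerivWithinAt_iteratedDerivWithin {s k : ℕ} {g : ℝ → ℝ}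
    (hg : ContDiffOn ℝ s g profileInterval) (hk : k < s) {t : ℝ} (ht : t ∈ profileInterval) :
    HasDerivWithinAt (iteratedDerivWithin k g profileInterval)
      (iteratedDerivWithin (k + 1) g profileInterval t) profileInterval t := by
  rw [iteratedDerivWithin_succ]
  exact ((hg.differentiableOn_iteratedDerivWithin (by exact_mod_cast hk)
    uniqueDiffOn_profileInterval) t ht).hasDerivWithinAt

theorem abs_le_of_csNorm_le {s k : ℕ} {g : ℝ → ℝ} (h : csNorm s g ≤ 1) (hk : k ≤ s) {t : ℝ}
    (ht : t ∈ profileInterval) : |iteratedDerivWithin k g profileInterval t| ≤ 1 := by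
  have h1 : ‖iteratedDerivWithin k g profileInterval t‖ₑ ≤ 1 := by
    simp only [csNorm, iSup_le_iff] at h
    exact h k hk t ht
  rw [← ofReal_norm, ENNReal.ofReal_le_one] at h1
  exact h1

theorem abs_le_of_smoothNorm_le {g : ℝ → ℝ} (h : smoothNorm g ≤ 1) (k : ℕ) {t : ℝ}
    (ht : t ∈ profileInterval) : |iteratedDerivWithin k g profileInterval t| ≤ 1 := by
  refine abs_le_of_csNorm_le (s := k) (le_trans ?_ h) le_rfl ht
  exact iSup_mono fun k => iSup_le fun _ => le_rfl

theorem abs_sub_le_of_holderConst_le {β : ℝ} (hβ : 0 < β) {g : ℝ → ℝ} (h : holderConst β g ≤ 1)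
    {x y : ℝ} (hx : x ∈ profileInterval) (hy : y ∈ profileInterval) :
    |g x - g y| ≤ 2 * |x - y| ^ β := by
  rcases eq_or_ne x y with rfl | hxy
  · simp [Real.zero_rpow hβ.ne']
  simp only [holderConst, iSup_le_iff] at h
  have h1 := h x hx y hy hxy
  have h0 : 0 < |x - y| := abs_pos.2 (sub_ne_zero.2 hxy)
  rw [ENNReal.ofReal_le_one, div_le_one (by positivity)] at h1
  refine h1.trans ?_
  gcongr
  exact min_le_right _ _

theorem strictFloor_lt {α : ℝ} (hα : 0 < α) : (strictFloor α : ℝ) < α := by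
  have h1 : 1 ≤ ⌈α⌉₊ := Nat.one_le_iff_ne_zero.2 (Nat.ceil_pos.2 hα).ne'
  rw [strictFloor, Nat.cast_sub h1]
  have := Nat.ceil_lt_add_one hα.le
  push_cast; linarith

theorem sub_strictFloor_le_one (α : ℝ) : α - strictFloor α ≤ 1 := by
  have h0 : (⌈α⌉₊ : ℝ) ≤ ((⌈α⌉₊ - 1 : ℕ) : ℝ) + 1 := by
    exact_mod_cast (by omega : ⌈α⌉₊ ≤ (⌈α⌉₊ - 1) + 1)
  have := Nat.le_ceil α
  rw [strictFloor]; linarith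

theorem InProfileBall.isHolderProfile_of_lt_top {α : ℝ≥0∞} {g : ℝ → ℝ} (hα : 0 < α) (hα' : α < ⊤)
    (h : InProfileBall α g) :
    IsHolderProfile (strictFloor α.toReal) (α.toReal - strictFloor α.toReal) g := by
  rw [InProfileBall, if_neg hα'.ne] at h
  obtain ⟨h1, h2⟩ := h
  rw [lipNorm, max_le_iff] at h2
  have hpos : 0 < α.toReal := ENNReal.toReal_pos hα.ne' hα'.ne
  exact ⟨h1, fun k hk t ht => abs_le_of_csNorm_le h2.1 hk ht, fun x hx y hy =>
    abs_sub_le_of_holderConst_le (sub_pos.2 (strictFloor_lt hpos)) h2.2 hx hy⟩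

theorem InProfileBall.isHolderProfile_of_top {g : ℝ → ℝ} (h : InProfileBall ⊤ g) (s : ℕ) :
    IsHolderProfile s 1 g := by
  rw [InProfileBall, if_pos rfl] at h
  obtain ⟨h1, h2⟩ := h
  refine ⟨h1.of_le (by exact_mod_cast le_top), fun k _ t ht => abs_le_of_smoothNorm_le h2 k ht,
    fun x hx y hy => ?_⟩
  have h3 := convex_profileInterval.norm_image_sub_le_of_norm_hasDerivWithin_le
    (fun t ht => hasDerivWithinAt_iteratedDerivWithin (s := s + 1) (k := s)
      (h1.of_le (by exact_mod_cast le_top)) (Nat.lt_succ_self s) ht)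
    (fun t ht => abs_le_of_smoothNorm_le h2 (s + 1) ht) hy hx
  rw [Real.norm_eq_abs, Real.norm_eq_abs] at h3
  rw [Real.rpow_one]
  linarith [abs_nonneg (x - y)]

theorem IsHolderProfile.continuousOn {s : ℕ} {β : ℝ} {g : ℝ → ℝ} (h : IsHolderProfile s β g) :
    ContinuousOn g profileInterval := h.contDiffOn.continuousOn

theorem IsHolderProfile.zero (s : ℕ) (β : ℝ) : IsHolderProfile s β (fun _ => 0) := by
  refine ⟨contDiffOn_const, fun k _ t _ => ?_, fun x _ y _ => ?_⟩
  · simp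
  · simp; positivity

theorem IsHolderProfile.abs_sub_le {s : ℕ} {β : ℝ} (hβ : β ≤ 1) {g : ℝ → ℝ}
    (h : IsHolderProfile s β g) {k : ℕ} (hk : k ≤ s) {x y : ℝ} (hx : x ∈ profileInterval)
    (hy : y ∈ profileInterval) (hxy : |x - y| ≤ 1) :
    |iteratedDerivWithin k g profileInterval x - iteratedDerivWithin k g profileInterval y| ≤
      2 * |x - y| ^ β := by
  rcases hk.eq_or_lt with rfl | hk
  · exact h.holder x hx y hy
  have h3 := convex_profileInterval.norm_image_sub_le_of_norm_hasDerivWithin_le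
    (fun t ht => hasDerivWithinAt_iteratedDerivWithin h.contDiffOn hk ht)
    (fun t ht => h.abs_le (k + 1) hk t ht) hy hx
  rw [Real.norm_eq_abs, Real.norm_eq_abs] at h3
  have h4 : |x - y| ≤ |x - y| ^ β := by
    rcases (abs_nonneg (x - y)).eq_or_lt with h0 | h0
    · rw [← h0]; positivity
    · simpa using Real.rpow_le_rpow_of_exponent_ge h0 hxy hβ
  linarith [abs_nonneg (x - y)]

theorem IsHolderProfile.abs_apply_sub_le {s : ℕ} {β : ℝ} {g : ℝ → ℝ}
    (h : IsHolderProfile s β g) (hs : 1 ≤ s) {x y : ℝ} (hx : x ∈ profileInterval)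
    (hy : y ∈ profileInterval) : |g x - g y| ≤ |x - y| := by
  have h3 := convex_profileInterval.norm_image_sub_le_of_norm_hasDerivWithin_le
    (fun t ht => hasDerivWithinAt_iteratedDerivWithin (k := 0) h.contDiffOn (by omega) ht)
    (fun t ht => h.abs_le 1 hs t ht) hy hx
  simpa using h3

/-! ### Taylor expansion -/

/-- Taylor's formula on `[0,1]` for a tower of successive derivatives whose top member oscillates
by at most `M`; the remainder carries the factor `1 / n!`. -/
theorem abs_sub_taylor_le_of_tower (n : ℕ) : ∀ (F : ℕ → ℝ → ℝ) (M : ℝ),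
    (∀ k < n, ∀ u ∈ Set.Icc (0 : ℝ) 1, HasDerivWithinAt (F k) (F (k + 1) u) (Set.Icc 0 1) u) →
    (∀ u ∈ Set.Icc (0 : ℝ) 1, |F n u - F n 0| ≤ M) → ∀ u ∈ Set.Icc (0 : ℝ) 1,
      |F 0 u - ∑ k ∈ Finset.range (n + 1), F k 0 * u ^ k / k.factorial| ≤
        M * u ^ n / n.factorial := by
  induction n with
  | zero => intro F M _ h u hu; simpa using h u hu
  | succ n ih =>
    intro F M hF hM
    have IH := ih (fun k => F (k + 1)) M (fun k hk => hF (k + 1) (by omega)) hM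
    have hpoly : ∀ u : ℝ, HasDerivAt
        (fun u => ∑ k ∈ Finset.range (n + 1 + 1), F k 0 * u ^ k / k.factorial)
        (∑ k ∈ Finset.range (n + 1), F (k + 1) 0 * u ^ k / k.factorial) u := by
      intro u
      have : (fun u : ℝ => ∑ k ∈ Finset.range (n + 1 + 1), F k 0 * u ^ k / k.factorial) =
          fun u => (∑ k ∈ Finset.range (n + 1),
            F (k + 1) 0 * u ^ (k + 1) / (k + 1).factorial) + F 0 0 := by
        ext u
        rw [Finset.sum_range_succ']
        simp
      rw [this]
      refine HasDerivAt.add_const _ (HasDerivAt.fun_sum fun k _ => ?_)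
      have h1 := (((hasDerivAt_pow (k + 1) u).const_mul (F (k + 1) 0)).div_const
        ((k + 1).factorial : ℝ))
      refine h1.congr_deriv ?_
      have : (k.factorial : ℝ) ≠ 0 := by positivity
      rw [Nat.factorial_succ]; push_cast
      field_simp
    have hcont : ContinuousOn
        (fun u => F 0 u - ∑ k ∈ Finset.range (n + 1 + 1), F k 0 * u ^ k / k.factorial)
        (Set.Icc 0 1) := fun u hu =>
      ((hF 0 (by omega) u hu).sub (hpoly u).hasDerivWithinAt).continuousWithinAt
    intro u hu
    have key := image_norm_le_of_norm_deriv_right_le_deriv_boundary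
      (f := fun u => F 0 u - ∑ k ∈ Finset.range (n + 1 + 1), F k 0 * u ^ k / k.factorial)
      (f' := fun u => F 1 u - ∑ k ∈ Finset.range (n + 1), F (k + 1) 0 * u ^ k / k.factorial)
      (B := fun u => M * u ^ (n + 1) / (n + 1).factorial)
      (B' := fun u => M * u ^ n / n.factorial) hcont ?_ ?_ ?_ ?_ hu
    · exact key
    · intro x hx
      have h1 := (hF 0 (by omega) x ⟨hx.1, hx.2.le⟩).sub (hpoly x).hasDerivWithinAt
      have h2 : HasDerivWithinAt _ _ (Set.Ico x 1) x := h1.mono fun y hy =>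
        ⟨hx.1.trans hy.1, hy.2.le⟩
      exact h2.mono_of_mem_nhdsWithin (Ico_mem_nhdsGE hx.2)
    · rw [Finset.sum_range_succ']
      simp
    · intro x
      have h1 := (((hasDerivAt_pow (n + 1) x).const_mul M).div_const ((n + 1).factorial : ℝ))
      refine h1.congr_deriv ?_
      have : (n.factorial : ℝ) ≠ 0 := by positivity
      rw [Nat.factorial_succ]; push_cast
      field_simp
    · intro x hx
      exact IH x ⟨hx.1, hx.2.le⟩

/-- Taylor's formula for a Hölder profile, between any two points of `[-1,1]`. -/
theorem IsHolderProfile.abs_sub_taylor_le {s : ℕ} {β : ℝ} (hβ : 0 < β) {g : ℝ → ℝ}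
    (h : IsHolderProfile s β g) {t₀ t τ : ℝ} (ht₀ : t₀ ∈ profileInterval)
    (ht : t ∈ profileInterval) (hτ : |t - t₀| ≤ τ) :
    |g t - ∑ k ∈ Finset.range (s + 1),
        iteratedDerivWithin k g profileInterval t₀ * (t - t₀) ^ k / k.factorial| ≤
      2 * τ ^ (s + β) / s.factorial := by
  have hmem : ∀ u ∈ Set.Icc (0 : ℝ) 1, t₀ + u * (t - t₀) ∈ profileInterval := fun u hu => by
    have := convex_profileInterval.add_smul_sub_mem ht₀ ht hu
    simpa using this
  have key := abs_sub_taylor_le_of_tower s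
    (fun k u => iteratedDerivWithin k g profileInterval (t₀ + u * (t - t₀)) * (t - t₀) ^ k)
    (2 * τ ^ (s + β)) ?_ ?_ 1 (by simp)
  · simpa using key
  · intro k hk u hu
    have h1 := hasDerivWithinAt_iteratedDerivWithin h.contDiffOn hk (hmem u hu)
    have h2 : HasDerivWithinAt (fun u : ℝ => t₀ + u * (t - t₀)) (t - t₀) (Set.Icc 0 1) u := by
      simpa using (((hasDerivAt_id u).mul_const (t - t₀)).const_add t₀).hasDerivWithinAt
    have h3 := (h1.comp u h2 hmem).mul_const ((t - t₀) ^ k)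
    refine h3.congr_deriv ?_
    ring
  · intro u hu
    have h1 := h.holder _ (hmem u hu) _ (hmem 0 (by simp))
    have h0 : 0 ≤ |t - t₀| := abs_nonneg _
    have hτ0 : 0 ≤ τ := h0.trans hτ
    rw [← sub_mul, abs_mul, abs_pow, add_comm (s : ℝ) β, Real.rpow_add_natCast' hτ0
      (by positivity), ← mul_assoc]
    refine mul_le_mul (h1.trans ?_) (by gcongr) (by positivity) (by positivity)
    gcongr
    have : t₀ + u * (t - t₀) - (t₀ + 0 * (t - t₀)) = u * (t - t₀) := by ring
    rw [this, abs_mul, abs_of_nonneg hu.1]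
    calc u * |t - t₀| ≤ 1 * |t - t₀| := by gcongr; exact hu.2
      _ ≤ τ := by simpa using hτ

/-! ### Mixed differences -/

/-- The iterated forward difference of `f` at `x`, with one step for each entry of the list. -/
def mixedDiff {E : Type*} [Add E] : List E → (E → ℝ) → E → ℝ
  | [], f, x => f x
  | v :: l, f, x => mixedDiff l (fun y => f (y + v) - f y) x

/-- The mean value theorem for mixed differences: they equal the product of the steps times an
intermediate value of the derivative of the corresponding order. -/
theorem exists_mixedDiff_eq (l : List ℝ) : ∀ (F : ℕ → ℝ → ℝ) (t : ℝ),
    (∀ j < l.length, ∀ u, |u - t| ≤ (l.map fun b => |b|).sum →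
      HasDerivAt (F j) (F (j + 1) u) u) →
    ∃ ξ, |ξ - t| ≤ (l.map fun b => |b|).sum ∧
      mixedDiff l (F 0) t = l.prod * F l.length ξ := by
  induction l with
  | nil => intro F t _; exact ⟨t, by simp, by simp [mixedDiff]⟩
  | cons b l ih =>
    intro F t hF
    simp only [List.map_cons, List.sum_cons, List.length_cons] at hF ⊢
    have hsum : ∀ u, |u - t| ≤ (l.map fun b => |b|).sum → ∀ v, |v - u| ≤ |b| →
        |v - t| ≤ |b| + (l.map fun b => |b|).sum := fun u hu v hv => by
      have := abs_sub_le v u t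
      linarith
    obtain ⟨ξ, hξ, hE⟩ := ih (fun j u => F j (u + b) - F j u) t (fun j hj u hu => by
      have h1 := (hF j (by omega) (u + b) (hsum u hu _ (by simp))).comp_add_const u b
      exact h1.sub (hF j (by omega) u (hsum u hu _ (by simp))))
    have hmvt : ∃ η, |η - ξ| ≤ |b| ∧ F l.length (ξ + b) - F l.length ξ =
        b * F (l.length + 1) η := by
      have hd : ∀ v, |v - ξ| ≤ |b| → HasDerivAt (F l.length) (F (l.length + 1) v) v :=
        fun v hv => hF _ (by omega) v (hsum ξ hξ v hv)
      rcases lt_trichotomy b 0 with hb | hb | hb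
      · have hI : ∀ v ∈ Set.Icc (ξ + b) ξ, |v - ξ| ≤ |b| := fun v hv => by
          rw [abs_of_neg hb, abs_le]; constructor <;> linarith [hv.1, hv.2]
        obtain ⟨c, hc, hc'⟩ := exists_hasDerivAt_eq_slope (F l.length) (F (l.length + 1))
          (show ξ + b < ξ by linarith)
          (fun v hv => (hd v (hI v hv)).continuousAt.continuousWithinAt)
          (fun v hv => hd v (hI v ⟨hv.1.le, hv.2.le⟩))
        refine ⟨c, hI c ⟨hc.1.le, hc.2.le⟩, ?_⟩
        rw [hc']
        have : ξ - (ξ + b) ≠ 0 := by simpa using hb.ne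
        field_simp
        ring
      · subst hb; exact ⟨ξ, by simp, by simp⟩
      · have hI : ∀ v ∈ Set.Icc ξ (ξ + b), |v - ξ| ≤ |b| := fun v hv => by
          rw [abs_of_pos hb, abs_le]; constructor <;> linarith [hv.1, hv.2]
        obtain ⟨c, hc, hc'⟩ := exists_hasDerivAt_eq_slope (F l.length) (F (l.length + 1))
          (show ξ < ξ + b by linarith)
          (fun v hv => (hd v (hI v hv)).continuousAt.continuousWithinAt)
          (fun v hv => hd v (hI v ⟨hv.1.le, hv.2.le⟩))
        refine ⟨c, hI c ⟨hc.1.le, hc.2.le⟩, ?_⟩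
        rw [hc']
        have : ξ + b - ξ = b := by ring
        rw [this]
        field_simp
    obtain ⟨η, hη, hη'⟩ := hmvt
    refine ⟨η, hsum ξ hξ η hη, ?_⟩
    rw [mixedDiff, hE, hη', List.prod_cons]
    ring

/-- Mixed differences of a ridge function are mixed differences of its profile. -/
theorem mixedDiff_comp {E : Type*} [AddCommMonoid E] (L : E →+ ℝ) (l : List E) :
    ∀ (g : ℝ → ℝ) (x : E),
      mixedDiff l (fun y => g (L y)) x = mixedDiff (l.map L) g (L x) := by
  induction l with
  | nil => intro g x; rfl
  | cons v l ih =>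
    intro g x
    simp only [mixedDiff, List.map_cons, map_add]
    exact ih (fun t => g (t + L v) - g t) x

open scoped Pointwise in
/-- The mixed difference only depends on the values at the base point plus sums of as many
admissible steps as the order of the difference. -/
theorem mixedDiff_congr {E : Type*} [AddCommMonoid E] [DecidableEq E] (D : Finset E)
    (h0 : 0 ∈ D) (l : List E) (hl : ∀ v ∈ l, v ∈ D) : ∀ (f f' : E → ℝ) (x : E),
    (∀ y ∈ l.length • D, f (x + y) = f' (x + y)) → mixedDiff l f x = mixedDiff l f' x := by
  induction l with
  | nil => intro f f' x h; simpa [mixedDiff] using h 0 (by simp)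
  | cons v l ih =>
    intro f f' x h
    refine ih (fun w hw => hl w (List.mem_cons_of_mem _ hw)) _ _ x fun y hy => ?_
    have h1 := h (y + v) (by
      rw [List.length_cons, succ_nsmul]
      exact Finset.add_mem_add hy (hl v List.mem_cons_self))
    have h2 := h y (Finset.nsmul_subset_nsmul_right h0 (Nat.le_succ l.length) hy)
    simp only [add_assoc]
    rw [h1, h2]

/-! ### Adaptive information -/

theorem sampleValues_apply {d : ℕ} (point : (k : ℕ) → (Fin k → ℝ) → UnitBall d)
    (f : UnitBall d → ℝ) (m : ℕ) (i : Fin m) :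
    sampleValues point f m i = f (point i (sampleValues point f i)) := by
  induction m with
  | zero => exact i.elim0
  | succ m ih =>
    refine Fin.lastCases ?_ (fun j => ?_) i
    · simp [sampleValues]
    · simp [sampleValues, ih j]

theorem sampleValues_eq_of_le {d : ℕ} {point : (k : ℕ) → (Fin k → ℝ) → UnitBall d}
    {f f' : UnitBall d → ℝ} {m : ℕ} (h : sampleValues point f m = sampleValues point f' m)
    {k : ℕ} (hk : k ≤ m) : sampleValues point f k = sampleValues point f' k := by
  induction m, hk using Nat.le_induction with
  | base => exact h
  | succ n hn ih =>
    refine ih ?_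
    have h1 := congrArg (fun v => Fin.init (α := fun _ => ℝ) v) h
    simpa only [sampleValues, Fin.init_snoc] using h1

theorem apply_point_eq_of_sampleValues_eq {d : ℕ} {point : (k : ℕ) → (Fin k → ℝ) → UnitBall d}
    {f f' : UnitBall d → ℝ} {m : ℕ} (h : sampleValues point f m = sampleValues point f' m)
    {k : ℕ} (hk : k < m) :
    f (point k (sampleValues point f k)) = f' (point k (sampleValues point f k)) := by
  have h1 := congrFun h ⟨k, hk⟩
  rw [sampleValues_apply, sampleValues_apply] at h1
  simpa [sampleValues_eq_of_le h hk.le] using h1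

theorem sampleValues_eq_zero {d : ℕ} (point : (k : ℕ) → (Fin k → ℝ) → UnitBall d)
    (f : UnitBall d → ℝ) (m : ℕ) (h : ∀ k < m, f (point k 0) = 0) :
    sampleValues point f m = 0 := by
  induction m with
  | zero => exact Subsingleton.elim _ _
  | succ m ih =>
    ext i
    rw [sampleValues, ih fun k hk => h k (by omega)]
    refine Fin.lastCases ?_ (fun j => ?_) i
    · simpa using h m (by omega)
    · simp

open Classical in
/-- The reconstruction for an abstract information map: return any function of the class that has
the given information, and zero for zero information. -/
noncomputable def consistentReconstruction {d m : ℕ} (F : Set (UnitBall d → ℝ))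
    (point : (k : ℕ) → (Fin k → ℝ) → UnitBall d)
    (hF : ∀ f ∈ F, MemLp f ⊤ (ballMeasure d)) (y : Fin m → ℝ) : Lp ℝ ⊤ (ballMeasure d) :=
  if h : y ≠ 0 ∧ ∃ f ∈ F, sampleValues point f m = y then
    (hF h.2.choose h.2.choose_spec.1).toLp _ else 0

/-- If the information determines the functions of a class up to `ε`, then answering with an
arbitrary consistent function of the class has error at most `ε`. -/
theorem samplingNumber_le_of_information {d m : ℕ} {F : Set (UnitBall d → ℝ)} {ε : ℝ}
    (point : (k : ℕ) → (Fin k → ℝ) → UnitBall d) (hF : ∀ f ∈ F, Continuous f)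
    (h : ∀ f ∈ F, ∀ f' ∈ F, sampleValues point f m = sampleValues point f' m →
      ∀ x, |f x - f' x| ≤ ε)
    (h0 : ∀ f ∈ F, sampleValues point f m = 0 → ∀ x, |f x| ≤ ε) :
    samplingNumber F m ≤ ENNReal.ofReal ε := by
  have hF' : ∀ f ∈ F, MemLp f ⊤ (ballMeasure d) := fun f hf => by
    obtain ⟨C, hC⟩ := isCompact_univ.exists_bound_of_continuousOn (hF f hf).continuousOn
    exact memLp_top_of_bound (hF f hf).aestronglyMeasurable C
      (Eventually.of_forall fun x => hC x (Set.mem_univ x))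
  let S : SamplingAlgorithm d m :=
    { point := point
      reconstruct := consistentReconstruction F point hF'
      reconstruct_zero := by simp [consistentReconstruction] }
  refine (iInf_le_of_le m <| iInf_le_of_le le_rfl <| iInf_le_of_le S le_rfl).trans ?_
  refine iSup₂_le fun f hf => ?_
  rw [eLpNorm_exponent_top]
  refine essSup_le_of_ae_le _ ?_
  have hbd : ∀ r : ℝ, |r| ≤ ε → ‖r‖ₑ ≤ ENNReal.ofReal ε := fun r hr => by
    rw [← ofReal_norm]; exact ENNReal.ofReal_le_ofReal hr
  by_cases hy : sampleValues point f m = 0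
  · have : S.output f = 0 := by
      simp only [SamplingAlgorithm.output, S, consistentReconstruction]
      rw [dif_neg fun h => h.1 hy]
    rw [this]
    filter_upwards [Lp.coeFn_zero ℝ ⊤ (ballMeasure d)] with x hx
    rw [hx]
    simpa using hbd _ (h0 f hf hy x)
  · have hex : sampleValues point f m ≠ 0 ∧
        ∃ f' ∈ F, sampleValues point f' m = sampleValues point f m := ⟨hy, f, hf, rfl⟩
    have : S.output f = (hF' hex.2.choose hex.2.choose_spec.1).toLp _ := by
      simp only [SamplingAlgorithm.output, S, consistentReconstruction]
      rw [dif_pos hex]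
    rw [this]
    filter_upwards [(hF' hex.2.choose hex.2.choose_spec.1).coeFn_toLp] with x hx
    rw [hx]
    exact hbd _ (h f hf _ hex.2.choose_spec.1 hex.2.choose_spec.2.symm x)

/-- A finite set of sampling points that determines the functions of a class up to `ε` bounds the
sampling numbers. -/
theorem samplingNumber_le_of_finset {d n : ℕ} {F : Set (UnitBall d → ℝ)} {ε : ℝ}
    (X : Finset (UnitBall d)) (hX : X.card ≤ n) (hF : ∀ f ∈ F, Continuous f)
    (hF0 : (fun _ => 0) ∈ F)
    (h : ∀ f ∈ F, ∀ f' ∈ F, (∀ x ∈ X, f x = f' x) → ∀ x, |f x - f' x| ≤ ε) :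
    samplingNumber F n ≤ ENNReal.ofReal ε := by
  let point : (k : ℕ) → (Fin k → ℝ) → UnitBall d := fun k _ =>
    if hk : k < X.card then X.equivFin.symm ⟨k, hk⟩ else ⟨0, by simp⟩
  have hagree : ∀ f f' : UnitBall d → ℝ,
      sampleValues point f X.card = sampleValues point f' X.card → ∀ x ∈ X, f x = f' x := by
    intro f f' hff x hx
    have h1 := apply_point_eq_of_sampleValues_eq hff (X.equivFin ⟨x, hx⟩).2
    simpa [point] using h1
  have hle : samplingNumber F X.card ≤ ENNReal.ofReal ε :=
    samplingNumber_le_of_information point hF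
      (fun f hf f' hf' hff => h f hf f' hf' (hagree f f' hff)) fun f hf hf0 x => by
        have h1 := h f hf _ hF0 (hagree f _ (hf0.trans
          (sampleValues_eq_zero point _ _ fun _ _ => rfl).symm)) x
        simpa using h1
  refine le_trans ?_ hle
  exact le_iInf₂ fun m hm => iInf₂_le
    (f := fun m _ => ⨅ S : SamplingAlgorithm d m, S.worstCaseError F) m (le_trans hm hX)

theorem infoComplexity_le {F : (d : ℕ) → Set (UnitBall d → ℝ)} {ε : ℝ} {d n : ℕ} (hn : 1 ≤ n)
    (h : samplingNumber (F d) n ≤ ENNReal.ofReal ε) : infoComplexity F ε d ≤ n :=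
  iInf₂_le n ⟨hn, h⟩

theorem one_le_infoComplexity (F : (d : ℕ) → Set (UnitBall d → ℝ)) (ε : ℝ) (d : ℕ) :
    1 ≤ infoComplexity F ε d :=
  le_iInf₂ fun n hn => by exact_mod_cast hn.1

/-! ### Fooling functions -/

/-- If every sampling point detects at most one of the functions `f i`, then fewer sampling points
than functions leave one of them indistinguishable from zero, so that the error is at least its
norm. -/
theorem le_samplingNumber_of_fooling {d n : ℕ} {F : Set (UnitBall d → ℝ)} {ι : Type*}
    {A : Finset ι} {f : ι → UnitBall d → ℝ} {r : ℝ≥0∞} (hf : ∀ i ∈ A, f i ∈ F)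
    (hdisj : ∀ i ∈ A, ∀ j ∈ A, ∀ x, f i x ≠ 0 → f j x ≠ 0 → i = j)
    (hr : ∀ i ∈ A, r ≤ eLpNorm (f i) ⊤ (ballMeasure d)) (hn : n < A.card) :
    r ≤ samplingNumber F n := by
  classical
  refine le_iInf₂ fun m hm => le_iInf fun S => ?_
  obtain ⟨i, hi, hi0⟩ : ∃ i ∈ A, ∀ k < m, f i (S.point k 0) = 0 := by
    by_contra! hcon
    choose! k hk hk' using hcon
    have := Finset.card_le_card_of_injOn (s := A) (t := Finset.range m) k
      (fun i hi => by simpa using hk i hi)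
      (fun i hi j hj hij => hdisj i hi j hj _ (hk' i hi) (by rw [hij]; exact hk' j hj))
    rw [Finset.card_range] at this
    omega
  refine le_trans ?_ (le_iSup₂ (f := fun f _ =>
    eLpNorm (fun x => f x - S.output f x) ⊤ (ballMeasure d)) (f i) (hf i hi))
  refine (hr i hi).trans_eq (eLpNorm_congr_ae ?_)
  have : S.output (f i) = 0 := by
    rw [SamplingAlgorithm.output, sampleValues_eq_zero _ _ _ hi0, S.reconstruct_zero]
  rw [this]
  filter_upwards [Lp.coeFn_zero ℝ ⊤ (ballMeasure d)] with x hx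
  rw [hx, Pi.zero_apply, sub_zero]

theorem card_le_infoComplexity_of_fooling {F : (d : ℕ) → Set (UnitBall d → ℝ)} {d : ℕ} {ι : Type*}
    {A : Finset ι} {f : ι → UnitBall d → ℝ} {r : ℝ≥0∞} {ε : ℝ} (hf : ∀ i ∈ A, f i ∈ F d)
    (hdisj : ∀ i ∈ A, ∀ j ∈ A, ∀ x, f i x ≠ 0 → f j x ≠ 0 → i = j)
    (hr : ∀ i ∈ A, r ≤ eLpNorm (f i) ⊤ (ballMeasure d)) (hε : ENNReal.ofReal ε < r) :
    (A.card : ℕ∞) ≤ infoComplexity F ε d := by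
  refine le_iInf₂ fun n hn => ?_
  by_contra! h
  exact absurd (le_samplingNumber_of_fooling hf hdisj hr (by exact_mod_cast h))
    (not_le.2 (hn.2.trans_lt hε))

/-! ### Local recovery -/

/-- The origin and the vectors `h e_i`. -/
noncomputable def stepSet (d : ℕ) (h : ℝ) : Finset (EuclideanSpace ℝ (Fin d)) :=
  insert 0 (Finset.univ.image fun i => EuclideanSpace.single i h)

theorem card_stepSet_le (d : ℕ) (h : ℝ) : (stepSet d h).card ≤ d + 1 := by
  refine (Finset.card_insert_le _ _).trans ?_
  gcongr
  simpa using Finset.card_image_le (s := Finset.univ)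
    (f := fun i : Fin d => EuclideanSpace.single i h)

open scoped Pointwise in
theorem norm_le_of_mem_nsmul_stepSet {d : ℕ} {h : ℝ} (hh : 0 ≤ h) (n : ℕ) :
    ∀ y ∈ n • stepSet d h, ‖y‖ ≤ n * h := by
  induction n with
  | zero => intro y hy; simp_all
  | succ n ih =>
    intro y hy
    rw [succ_nsmul, Finset.mem_add] at hy
    obtain ⟨u, hu, v, hv, rfl⟩ := hy
    have hv' : ‖v‖ ≤ h := by
      rw [stepSet, Finset.mem_insert, Finset.mem_image] at hv
      rcases hv with rfl | ⟨i, -, rfl⟩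
      · simpa using hh
      · simp [abs_of_nonneg hh]
    have := norm_add_le u v
    push_cast
    linarith [ih u hu]

theorem abs_inner_le_one {d : ℕ} {a x : EuclideanSpace ℝ (Fin d)} (ha : ‖a‖ ≤ 1) (hx : ‖x‖ ≤ 1) :
    |inner ℝ a x| ≤ 1 :=
  (abs_real_inner_le_norm a x).trans (mul_le_one₀ ha (norm_nonneg x) hx)

/-- Mixed differences of a ridge function along the coordinate directions are, up to a factor
`h ^ k`, the mixed partial derivatives with the profile evaluated at a nearby point. -/
theorem exists_mixedDiff_ridge_eq {d s k : ℕ} {β h : ℝ} {g : ℝ → ℝ}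
    (hg : IsHolderProfile s β g) {a x₀ : EuclideanSpace ℝ (Fin d)} (ha : ‖a‖ ≤ 1) (hh : 0 ≤ h)
    (hx₀ : ‖x₀‖ + s * h < 1) (hk : k ≤ s) (v : Fin k → Fin d) :
    ∃ ξ ∈ profileInterval, |ξ - inner ℝ a x₀| ≤ s * h ∧
      mixedDiff (List.ofFn fun i => EuclideanSpace.single (v i) h) (fun y => g (inner ℝ a y)) x₀ =
        h ^ k * ((∏ i, a (v i)) * iteratedDerivWithin k g profileInterval ξ) := by
  have hmap : (List.ofFn fun i => EuclideanSpace.single (v i) h).map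
      (innerₛₗ ℝ a).toAddMonoidHom = List.ofFn fun i => h * a (v i) := by
    rw [List.map_ofFn]
    congr 1
    ext i
    simp [EuclideanSpace.inner_single_right]
  have h1 := mixedDiff_comp (innerₛₗ ℝ a).toAddMonoidHom
    (List.ofFn fun i => EuclideanSpace.single (v i) h) g x₀
  rw [hmap] at h1
  have h1' : mixedDiff (List.ofFn fun i => EuclideanSpace.single (v i) h)
      (fun y => g (inner ℝ a y)) x₀ =
      mixedDiff (List.ofFn fun i => h * a (v i)) g (inner ℝ a x₀) := h1
  have hsum : ((List.ofFn fun i => h * a (v i)).map fun b => |b|).sum ≤ s * h := by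
    rw [List.map_ofFn, List.sum_ofFn]
    calc ∑ i : Fin k, |h * a (v i)| ≤ ∑ i : Fin k, h := by
          refine Finset.sum_le_sum fun i _ => ?_
          rw [abs_mul, abs_of_nonneg hh]
          have : |a (v i)| ≤ 1 := (PiLp.norm_apply_le a (v i)).trans ha
          nlinarith
      _ = k * h := by simp
      _ ≤ s * h := by gcongr
  have habs : |inner ℝ a x₀| ≤ ‖x₀‖ :=
    (abs_real_inner_le_norm a x₀).trans (mul_le_of_le_one_left (norm_nonneg _) ha)
  have hint : ∀ u, |u - inner ℝ a x₀| ≤ s * h → |u| < 1 := fun u hu => by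
    have := abs_sub_abs_le_abs_sub u (inner ℝ a x₀)
    linarith
  obtain ⟨ξ, hξ, hE⟩ := exists_mixedDiff_eq (List.ofFn fun i => h * a (v i))
    (fun j => iteratedDerivWithin j g profileInterval) (inner ℝ a x₀) (fun j hj u hu => by
      rw [List.length_ofFn] at hj
      have hu1 := hint u (hu.trans hsum)
      refine (hasDerivWithinAt_iteratedDerivWithin hg.contDiffOn (hj.trans_le hk)
        (mem_profileInterval.2 hu1.le)).hasDerivAt ?_
      rw [abs_lt] at hu1
      exact Icc_mem_nhds hu1.1 hu1.2)
  refine ⟨ξ, mem_profileInterval.2 (hint ξ (hξ.trans hsum)).le, hξ.trans hsum, ?_⟩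
  rw [h1', ← iteratedDerivWithin_zero (f := g) (s := profileInterval), hE, List.prod_ofFn,
    Finset.prod_mul_distrib, List.length_ofFn]
  simp [mul_assoc]

open scoped Pointwise in
/-- If two ridge functions agree on a small grid near `x₀`, then their mixed partial derivatives at
`x₀` are close to each other. -/
theorem abs_partialDeriv_sub_le {d s k : ℕ} {β h : ℝ} (hβ : 0 < β) (hβ1 : β ≤ 1) {g g' : ℝ → ℝ}
    (hg : IsHolderProfile s β g) (hg' : IsHolderProfile s β g')
    {a a' x₀ : EuclideanSpace ℝ (Fin d)} (ha : ‖a‖ ≤ 1) (ha' : ‖a'‖ ≤ 1) (hh : 0 < h)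
    (hx₀ : ‖x₀‖ + s * h < 1)
    (hagree : ∀ y ∈ s • stepSet d h, g (inner ℝ a (x₀ + y)) = g' (inner ℝ a' (x₀ + y)))
    (hk : k ≤ s) (v : Fin k → Fin d) :
    |iteratedDerivWithin k g profileInterval (inner ℝ a x₀) * ∏ i, a (v i) -
      iteratedDerivWithin k g' profileInterval (inner ℝ a' x₀) * ∏ i, a' (v i)| ≤
      4 * (s * h) ^ β := by
  obtain ⟨ξ, hξI, hξ, hE⟩ := exists_mixedDiff_ridge_eq hg ha hh.le hx₀ hk v
  obtain ⟨ξ', hξI', hξ', hE'⟩ := exists_mixedDiff_ridge_eq hg' ha' hh.le hx₀ hk v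
  have h0 : (0 : EuclideanSpace ℝ (Fin d)) ∈ stepSet d h := Finset.mem_insert_self _ _
  have heq := mixedDiff_congr (stepSet d h) h0
    (List.ofFn fun i => EuclideanSpace.single (v i) h) (fun w hw => by
      rw [List.mem_ofFn] at hw
      obtain ⟨i, rfl⟩ := hw
      exact Finset.mem_insert_of_mem (Finset.mem_image_of_mem _ (Finset.mem_univ _)))
    (fun y => g (inner ℝ a y)) (fun y => g' (inner ℝ a' y)) x₀ (fun y hy => by
      rw [List.length_ofFn] at hy
      exact hagree y (Finset.nsmul_subset_nsmul_right h0 hk hy))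
  rw [hE, hE', mul_right_inj' (by positivity)] at heq
  have hsh : s * h ≤ 1 := by linarith [norm_nonneg x₀]
  have hx1 : ‖x₀‖ ≤ 1 := by nlinarith [Nat.cast_nonneg (α := ℝ) s]
  have hbound : ∀ {G : ℝ → ℝ} {b : EuclideanSpace ℝ (Fin d)} {ζ : ℝ}, IsHolderProfile s β G →
      ‖b‖ ≤ 1 → ζ ∈ profileInterval → |ζ - inner ℝ b x₀| ≤ s * h →
      |iteratedDerivWithin k G profileInterval (inner ℝ b x₀) * ∏ i, b (v i) -
        (∏ i, b (v i)) * iteratedDerivWithin k G profileInterval ζ| ≤ 2 * (s * h) ^ β := by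
    intro G b ζ hG hb hζ hd
    have hprod : |∏ i, b (v i)| ≤ 1 := by
      rw [Finset.abs_prod]
      exact Finset.prod_le_one (fun _ _ => abs_nonneg _)
        fun i _ => (PiLp.norm_apply_le b (v i)).trans hb
    have h1 := hG.abs_sub_le hβ1 hk hζ (mem_profileInterval.2 (abs_inner_le_one hb hx1))
      (hd.trans hsh)
    rw [mul_comm _ (∏ i, b (v i)), ← mul_sub, abs_mul, abs_sub_comm]
    refine (mul_le_of_le_one_left (abs_nonneg _) hprod).trans (h1.trans ?_)
    gcongr
  have h1 := hbound hg ha hξI hξ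
  have h2 := hbound hg' ha' hξI' hξ'
  rw [heq] at h1
  rw [abs_sub_comm] at h2
  exact (abs_sub_le _ _ _).trans ((add_le_add h1 h2).trans_eq (by ring))

theorem mul_inner_pow_eq_sum {d : ℕ} (c : ℝ) (a u : EuclideanSpace ℝ (Fin d)) (k : ℕ) :
    c * inner ℝ a u ^ k = ∑ v : Fin k → Fin d, (c * ∏ i, a (v i)) * ∏ i, u (v i) := by
  have : (inner ℝ a u : ℝ) = ∑ i, a i * u i := by
    simp [PiLp.inner_apply, mul_comm]
  rw [this, Finset.sum_pow', Finset.mul_sum, Fintype.piFinset_univ]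
  refine Finset.sum_congr rfl fun v _ => ?_
  rw [Finset.prod_mul_distrib, mul_assoc]

open scoped Pointwise in
/-- Ridge functions that agree on a small grid near `x₀` have nearly the same Taylor polynomial at
`x₀`, so their distance is controlled by the Taylor remainders. -/
theorem abs_ridge_sub_le_of_agree {d s : ℕ} {β h τ : ℝ} (hβ : 0 < β) (hβ1 : β ≤ 1) {g g' : ℝ → ℝ}
    (hg : IsHolderProfile s β g) (hg' : IsHolderProfile s β g')
    {a a' x₀ x : EuclideanSpace ℝ (Fin d)} (ha : ‖a‖ ≤ 1) (ha' : ‖a'‖ ≤ 1) (hh : 0 < h)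
    (hx₀ : ‖x₀‖ + s * h < 1) (hx : ‖x‖ ≤ 1)
    (hagree : ∀ y ∈ s • stepSet d h, g (inner ℝ a (x₀ + y)) = g' (inner ℝ a' (x₀ + y)))
    (hτ : |inner ℝ a (x - x₀)| ≤ τ) (hτ' : |inner ℝ a' (x - x₀)| ≤ τ) :
    |g (inner ℝ a x) - g' (inner ℝ a' x)| ≤ 4 * τ ^ (s + β) / s.factorial +
      (∑ k ∈ Finset.range (s + 1), (2 * d : ℝ) ^ k) * (4 * (s * h) ^ β) := by
  have hx1 : ‖x₀‖ ≤ 1 := by nlinarith [Nat.cast_nonneg (α := ℝ) s]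
  have hT := hg.abs_sub_taylor_le hβ (mem_profileInterval.2 (abs_inner_le_one ha hx1))
    (mem_profileInterval.2 (abs_inner_le_one ha hx)) (τ := τ) (by rwa [← inner_sub_right])
  have hT' := hg'.abs_sub_taylor_le hβ (mem_profileInterval.2 (abs_inner_le_one ha' hx1))
    (mem_profileInterval.2 (abs_inner_le_one ha' hx)) (τ := τ) (by rwa [← inner_sub_right])
  rw [← inner_sub_right] at hT hT'
  have hpoly : |(∑ k ∈ Finset.range (s + 1), iteratedDerivWithin k g profileInterval
        (inner ℝ a x₀) * inner ℝ a (x - x₀) ^ k / k.factorial) -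
      ∑ k ∈ Finset.range (s + 1), iteratedDerivWithin k g' profileInterval
        (inner ℝ a' x₀) * inner ℝ a' (x - x₀) ^ k / k.factorial| ≤
      (∑ k ∈ Finset.range (s + 1), (2 * d : ℝ) ^ k) * (4 * (s * h) ^ β) := by
    rw [← Finset.sum_sub_distrib, Finset.sum_mul]
    refine (Finset.abs_sum_le_sum_abs _ _).trans (Finset.sum_le_sum fun k hk => ?_)
    rw [Finset.mem_range, Nat.lt_succ_iff] at hk
    rw [← sub_div, abs_div, Nat.abs_cast]
    refine (div_le_self (abs_nonneg _) (Nat.one_le_cast.2 k.factorial_pos)).trans ?_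
    rw [mul_inner_pow_eq_sum, mul_inner_pow_eq_sum, ← Finset.sum_sub_distrib]
    refine (Finset.abs_sum_le_sum_abs _ _).trans ?_
    calc _ ≤ ∑ _v : Fin k → Fin d, (4 * (s * h) ^ β) * 2 ^ k := by
          refine Finset.sum_le_sum fun v _ => ?_
          rw [← sub_mul, abs_mul]
          refine mul_le_mul (abs_partialDeriv_sub_le hβ hβ1 hg hg' ha ha' hh hx₀ hagree hk v) ?_
            (abs_nonneg _) (by positivity)
          rw [Finset.abs_prod]
          calc ∏ i, |(x - x₀) (v i)| ≤ ∏ _i : Fin k, (2 : ℝ) := by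
                refine Finset.prod_le_prod (fun _ _ => abs_nonneg _) fun i _ => ?_
                have h1 := PiLp.norm_apply_le (x - x₀) (v i)
                have h2 := norm_sub_le x x₀
                rw [Real.norm_eq_abs] at h1
                linarith
            _ = 2 ^ k := by simp
      _ = (2 * d : ℝ) ^ k * (4 * (s * h) ^ β) := by
          simp [mul_pow]; ring
  rw [abs_le] at hT hT' hpoly ⊢
  have e : 4 * τ ^ (s + β) / s.factorial =
    2 * τ ^ (s + β) / s.factorial + 2 * τ ^ (s + β) / s.factorial := by ring
  rw [e]
  constructor <;> linarith [hT.1, hT.2, hT'.1, hT'.2, hpoly.1, hpoly.2]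

theorem exists_small_step (s : ℕ) {β η ε : ℝ} (A : ℝ) (hβ : 0 < β) (hη : 0 < η) (hε : 0 < ε) :
    ∃ h : ℝ, 0 < h ∧ s * h < η ∧ A * (4 * (s * h) ^ β) < ε := by
  have h1 : Tendsto (fun h : ℝ => s * h) (𝓝[>] 0) (𝓝 0) := by
    have : Continuous fun h : ℝ => s * h := by fun_prop
    simpa using this.continuousWithinAt.tendsto (x := (0 : ℝ)) (s := Set.Ioi 0)
  have h2 : Tendsto (fun h : ℝ => A * (4 * (s * h) ^ β)) (𝓝[>] 0) (𝓝 0) := by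
    have h3 := ((h1.rpow_const (p := β) (Or.inr hβ.le)).const_mul 4).const_mul A
    simpa [Real.zero_rpow hβ.ne'] using h3
  obtain ⟨h, ⟨hh, hh'⟩, hpos⟩ := (((h1.eventually (gt_mem_nhds hη)).and
    (h2.eventually (gt_mem_nhds hε))).and self_mem_nhdsWithin).exists
  exact ⟨h, hpos, hh, hh'⟩

/-! ### Classes of ridge functions with Hölder profiles -/

/-- Ridge functions with a Hölder profile of smoothness `s + β` and direction in the unit ball of
`ℓ_r`. -/
def holderRidgeClass (s : ℕ) (β r : ℝ) (d : ℕ) : Set (UnitBall d → ℝ) :=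
  {f | ∃ (g : ℝ → ℝ) (a : EuclideanSpace ℝ (Fin d)), IsHolderProfile s β g ∧
    ∑ i, |a i| ^ r ≤ 1 ∧ ∀ x : UnitBall d, f x = g (inner ℝ a (x : EuclideanSpace ℝ (Fin d)))}

theorem sum_rpow_le_one_of_le {d : ℕ} {a : Fin d → ℝ} {p r : ℝ} (hp : 0 < p) (hpr : p ≤ r)
    (h : ∑ i, |a i| ^ p ≤ 1) : ∑ i, |a i| ^ r ≤ 1 := by
  refine (Finset.sum_le_sum fun i _ => ?_).trans h
  have h1 : |a i| ^ p ≤ 1 := (Finset.single_le_sum (f := fun i => |a i| ^ p)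
    (fun _ _ => by positivity) (Finset.mem_univ i)).trans h
  have h2 : |a i| ≤ 1 := by
    by_contra! hcon
    exact absurd h1 (not_le.2 (Real.one_lt_rpow hcon hp))
  rcases (abs_nonneg (a i)).eq_or_lt with h0 | h0
  · rw [← h0, Real.zero_rpow hp.ne', Real.zero_rpow (by linarith)]
  · exact Real.rpow_le_rpow_of_exponent_ge h0 h2 hpr

theorem norm_le_one_of_sum_rpow_le {d : ℕ} {a : EuclideanSpace ℝ (Fin d)} {r : ℝ} (hr : 0 < r)
    (hr2 : r ≤ 2) (h : ∑ i, |a i| ^ r ≤ 1) : ‖a‖ ≤ 1 := by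
  have h1 := sum_rpow_le_one_of_le hr hr2 h
  rw [EuclideanSpace.norm_eq, Real.sqrt_le_one]
  simpa using h1

theorem sum_rpow_le_one_of_lpQuasiNorm_le {d : ℕ} {a : EuclideanSpace ℝ (Fin d)} {p : ℝ}
    (hp : 0 < p) (h : lpQuasiNorm p a ≤ 1) : ∑ i, |a i| ^ p ≤ 1 := by
  by_contra! hcon
  exact absurd h (not_le.2 (Real.one_lt_rpow hcon (by positivity)))

theorem continuous_ridge {d s : ℕ} {β : ℝ} {g : ℝ → ℝ} (hg : IsHolderProfile s β g)
    {a : EuclideanSpace ℝ (Fin d)} (ha : ‖a‖ ≤ 1) {f : UnitBall d → ℝ}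
    (hf : ∀ x : UnitBall d, f x = g (inner ℝ a (x : EuclideanSpace ℝ (Fin d)))) :
    Continuous f := by
  rw [funext hf]
  exact hg.continuousOn.comp_continuous (by fun_prop) fun x =>
    mem_profileInterval.2 (abs_inner_le_one ha (mem_closedBall_zero_iff.1 x.2))

theorem zero_mem_holderRidgeClass (s : ℕ) (β : ℝ) {r : ℝ} (hr : 0 < r) (d : ℕ) :
    (fun _ => 0) ∈ holderRidgeClass s β r d :=
  ⟨fun _ => 0, 0, IsHolderProfile.zero s β, by simp [Real.zero_rpow hr.ne'], fun _ => rfl⟩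

theorem infoComplexity_mono {F F' : (d : ℕ) → Set (UnitBall d → ℝ)} {d : ℕ} (h : F d ⊆ F' d)
    (ε : ℝ) : infoComplexity F ε d ≤ infoComplexity F' ε d := by
  refine le_iInf₂ fun n hn => infoComplexity_le hn.1 (le_trans ?_ hn.2)
  exact iInf_mono fun m => iInf_mono fun _ => iInf_mono fun S =>
    iSup_le_iSup_of_subset h

open scoped Pointwise in
/-- Sampling on a small grid around each of finitely many centres: if every point of the ball is
close to a centre in the sense that all admissible directions see the two at distance at most `τ`,
then the error is governed by the Taylor remainder at distance `τ`. -/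
theorem infoComplexity_holderRidgeClass_le_of_centers {d s : ℕ} {β r ε η τ : ℝ} (hβ : 0 < β)
    (hβ1 : β ≤ 1) (hr : 0 < r) (hr2 : r ≤ 2) (hη : 0 < η)
    (Z : Finset (EuclideanSpace ℝ (Fin d))) (hZ : ∀ z ∈ Z, ‖z‖ ≤ 1 - η)
    (hcover : ∀ x : EuclideanSpace ℝ (Fin d), ‖x‖ ≤ 1 → ∃ z ∈ Z,
      ∀ a : EuclideanSpace ℝ (Fin d), ∑ i, |a i| ^ r ≤ 1 → |inner ℝ a (x - z)| ≤ τ)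
    (hε : 4 * τ ^ (s + β) / s.factorial < ε) :
    infoComplexity (holderRidgeClass s β r) ε d ≤ (Z.card * (d + 1) ^ s : ℕ) := by
  classical
  obtain ⟨h, hh, hh1, hh2⟩ := exists_small_step s (∑ k ∈ Finset.range (s + 1), (2 * d : ℝ) ^ k)
    hβ hη (sub_pos.2 hε)
  have hZne : 1 ≤ Z.card := by
    obtain ⟨z, hz, -⟩ := hcover 0 (by simp)
    exact Finset.card_pos.2 ⟨z, hz⟩
  refine infoComplexity_le (Nat.one_le_iff_ne_zero.2 (Nat.mul_ne_zero (by omega)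
    (pow_ne_zero _ (by omega)))) ?_
  have hY : ∀ z ∈ Z, ∀ y ∈ s • stepSet d h, ‖z + y‖ ≤ 1 := fun z hz y hy => by
    have h1 := norm_le_of_mem_nsmul_stepSet hh.le s y hy
    linarith [norm_add_le z y, hZ z hz]
  refine samplingNumber_le_of_finset
    ((Z + s • stepSet d h).subtype (· ∈ Metric.closedBall (0 : EuclideanSpace ℝ (Fin d)) 1))
    ?_ ?_ (zero_mem_holderRidgeClass s β hr d) ?_
  · rw [Finset.card_subtype]
    refine (Finset.card_filter_le _ _).trans (Finset.card_add_le.trans ?_)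
    gcongr
    exact Finset.card_nsmul_le.trans (by gcongr; exact card_stepSet_le d h)
  · rintro f ⟨g, a, hg, ha, hf⟩
    exact continuous_ridge hg (norm_le_one_of_sum_rpow_le hr hr2 ha) hf
  · rintro f ⟨g, a, hg, ha, hf⟩ f' ⟨g', a', hg', ha', hf'⟩ hagree x
    have hx : ‖(x : EuclideanSpace ℝ (Fin d))‖ ≤ 1 := mem_closedBall_zero_iff.1 x.2
    obtain ⟨z, hz, hzx⟩ := hcover x hx
    rw [hf x, hf' x]
    refine (abs_ridge_sub_le_of_agree hβ hβ1 hg hg' (norm_le_one_of_sum_rpow_le hr hr2 ha)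
      (norm_le_one_of_sum_rpow_le hr hr2 ha') hh (by linarith [hZ z hz]) hx ?_ (hzx a ha)
      (hzx a' ha')).trans (by linarith)
    intro y hy
    have h1 := hagree ⟨z + y, by simpa using hY z hz y hy⟩ (by
      rw [Finset.mem_subtype]; exact Finset.add_mem_add hz hy)
    rwa [hf, hf'] at h1

/-- Sampling near the origin only: the Taylor polynomial at the origin is accurate on the whole ball
when the profile has many bounded derivatives. -/
theorem infoComplexity_holderRidgeClass_le_of_factorial {s : ℕ} {β r ε : ℝ} (hβ : 0 < β)
    (hβ1 : β ≤ 1) (hr : 0 < r) (hr2 : r ≤ 2) (hε : 4 / s.factorial < ε) (d : ℕ) :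
    infoComplexity (holderRidgeClass s β r) ε d ≤ ((d + 1) ^ s : ℕ) := by
  have := infoComplexity_holderRidgeClass_le_of_centers (d := d) (s := s) (ε := ε) (τ := 1) hβ hβ1
    hr hr2 one_pos {0} (by simp) (fun x hx => ⟨0, by simp, fun a ha => by
      rw [sub_zero]; exact abs_inner_le_one (norm_le_one_of_sum_rpow_le hr hr2 ha) hx⟩)
    (by simpa using hε)
  simpa using this

/-! ### Rounding to an integer grid -/

/-- The origin and the signed unit vectors of `ℤ^d`. -/
def signedUnits (d : ℕ) : Finset (Fin d → ℤ) :=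
  insert 0 (Finset.univ.image (fun i => Pi.single i 1) ∪
    Finset.univ.image fun i => Pi.single i (-1))

theorem card_signedUnits_le (d : ℕ) : (signedUnits d).card ≤ 2 * d + 1 := by
  refine (Finset.card_insert_le _ _).trans ?_
  have h1 := Finset.card_image_le (s := Finset.univ) (f := fun i : Fin d => Pi.single i (1 : ℤ))
  have h2 := Finset.card_image_le (s := Finset.univ) (f := fun i : Fin d => Pi.single i (-1 : ℤ))
  have h3 := Finset.card_union_le
    (Finset.univ.image (fun i : Fin d => Pi.single (M := fun _ => ℤ) i (1 : ℤ)))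
    (Finset.univ.image fun i : Fin d => Pi.single (M := fun _ => ℤ) i (-1 : ℤ))
  simp only [Finset.card_univ, Fintype.card_fin] at h1 h2
  omega

open scoped Pointwise in
theorem mem_nsmul_signedUnits {d K : ℕ} : ∀ z : Fin d → ℤ, ∑ i, (z i).natAbs ≤ K →
    z ∈ K • signedUnits d := by
  induction K with
  | zero =>
    intro z hz
    have : z = 0 := by
      ext i
      have := Finset.sum_eq_zero_iff.1 (Nat.le_zero.1 hz) i (Finset.mem_univ i)
      simpa using this
    simp [this]
  | succ K ih =>
    intro z hz
    by_cases h0 : z = 0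
    · subst h0
      exact Finset.nsmul_subset_nsmul_right (Finset.mem_insert_self _ _) (Nat.zero_le _)
        (by simp)
    obtain ⟨i, hi⟩ := Function.ne_iff.1 h0
    have hsum : ∀ w : Fin d → ℤ, (∀ j ≠ i, w j = z j) → (w i).natAbs + 1 = (z i).natAbs →
        ∑ j, (w j).natAbs ≤ K := by
      intro w hw hwi
      rw [← Finset.add_sum_erase _ _ (Finset.mem_univ i)] at hz ⊢
      have : ∑ j ∈ Finset.univ.erase i, (w j).natAbs = ∑ j ∈ Finset.univ.erase i, (z j).natAbs :=
        Finset.sum_congr rfl fun j hj => by rw [hw j (Finset.ne_of_mem_erase hj)]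
      omega
    rw [succ_nsmul]
    rcases lt_or_gt_of_ne hi with hneg | hpos
    · have hneg : z i < 0 := hneg
      refine Finset.mem_add.2 ⟨z - Pi.single i (-1), ih _ (hsum _ ?_ ?_), Pi.single i (-1), ?_,
        sub_add_cancel _ _⟩
      · intro j hj; simp [hj]
      · simp only [Pi.sub_apply, Pi.single_eq_same]; omega
      · simp [signedUnits]
    · have hpos : 0 < z i := hpos
      refine Finset.mem_add.2 ⟨z - Pi.single i 1, ih _ (hsum _ ?_ ?_), Pi.single i 1, ?_,
        sub_add_cancel _ _⟩
      · intro j hj; simp [hj]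
      · simp only [Pi.sub_apply, Pi.single_eq_same]; omega
      · simp [signedUnits]

theorem exists_round_toward_zero {δ : ℝ} (hδ : 0 < δ) (x : ℝ) :
    ∃ z : ℤ, |x - δ * z| ≤ δ ∧ |x - δ * z| ≤ |x| ∧ |δ * z| ≤ |x| := by
  rcases le_total 0 x with hx | hx
  · have h1 : (⌊x / δ⌋ : ℝ) * δ ≤ x := (le_div_iff₀ hδ).1 (Int.floor_le _)
    have h2 : x ≤ (⌊x / δ⌋ + 1) * δ := (div_le_iff₀ hδ).1 (Int.lt_floor_add_one _).le
    have h3 : (0 : ℝ) ≤ ⌊x / δ⌋ := by exact_mod_cast Int.floor_nonneg.2 (by positivity)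
    have h4 := mul_nonneg h3 hδ.le
    refine ⟨⌊x / δ⌋, ?_, ?_, ?_⟩
    · rw [abs_le]; constructor <;> linarith
    · rw [abs_le, abs_of_nonneg hx]; constructor <;> linarith
    · rw [abs_le, abs_of_nonneg hx]; constructor <;> linarith
  · have h1 : x ≤ (⌈x / δ⌉ : ℝ) * δ := (div_le_iff₀ hδ).1 (Int.le_ceil _)
    have h2 : (⌈x / δ⌉ - 1 : ℝ) * δ ≤ x :=
      (le_div_iff₀ hδ).1 (by linarith [Int.ceil_lt_add_one (x / δ)])
    have h3 : (⌈x / δ⌉ : ℝ) ≤ 0 := by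
      exact_mod_cast Int.ceil_le.2 (by simpa using div_nonpos_of_nonpos_of_nonneg hx hδ.le)
    have h4 := mul_nonneg (neg_nonneg.2 h3) hδ.le
    refine ⟨⌈x / δ⌉, ?_, ?_, ?_⟩
    · rw [abs_le]; constructor <;> linarith
    · rw [abs_le, abs_of_nonpos hx]; constructor <;> linarith
    · rw [abs_le, abs_of_nonpos hx]; constructor <;> linarith

/-- Rounding a vector of the unit ball towards zero leaves at most `δ⁻²` nonzero units, counted with
multiplicity, because a nonzero integer is bounded by its square. -/
theorem exists_round_vector {d : ℕ} {δ : ℝ} (hδ : 0 < δ) {x : EuclideanSpace ℝ (Fin d)}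
    (hx : ‖x‖ ≤ 1) : ∃ z : Fin d → ℤ, ∑ i, (z i).natAbs ≤ ⌊(δ ^ 2)⁻¹⌋₊ ∧
      (∀ i, |x i - δ * z i| ≤ δ) ∧ ∑ i, |x i - δ * z i| ^ 2 ≤ 1 ∧
      ‖WithLp.toLp 2 fun i => δ * (z i : ℝ)‖ ≤ 1 := by
  choose z hz1 hz2 hz3 using fun i => exists_round_toward_zero hδ (x i)
  have hsq : ∑ i, |x i| ^ 2 ≤ 1 := by
    rw [EuclideanSpace.norm_eq, Real.sqrt_le_one] at hx
    simpa using hx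
  have hsqz : ∑ i, |δ * (z i : ℝ)| ^ 2 ≤ 1 :=
    (Finset.sum_le_sum fun i _ => pow_le_pow_left₀ (abs_nonneg _) (hz3 i) 2).trans hsq
  refine ⟨z, ?_, hz1, (Finset.sum_le_sum fun i _ =>
    pow_le_pow_left₀ (abs_nonneg _) (hz2 i) 2).trans hsq, ?_⟩
  · refine Nat.le_floor ?_
    rw [← one_div, le_div_iff₀ (by positivity)]
    refine le_trans ?_ hsqz
    push_cast
    rw [Finset.sum_mul]
    refine Finset.sum_le_sum fun i _ => ?_
    rw [abs_mul, mul_pow, sq_abs, mul_comm, Nat.cast_natAbs]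
    gcongr
    rw [Int.cast_abs]
    rcases eq_or_ne (z i) 0 with h0 | h0
    · simp [h0]
    · have : (1 : ℝ) ≤ |(z i : ℝ)| := by exact_mod_cast Int.one_le_abs h0
      nlinarith
  · rw [EuclideanSpace.norm_eq, Real.sqrt_le_one]
    simpa using hsqz

/-- Hölder's inequality combined with the interpolation of `ℓ_q`, `q ≥ 2`, between `ℓ_2` and
`ℓ_∞`. -/
theorem abs_sum_mul_le_rpow {d : ℕ} {a y : Fin d → ℝ} {r δ : ℝ} (hr1 : 1 ≤ r) (hr2 : r ≤ 2)
    (hδ : 0 < δ) (ha : ∑ i, |a i| ^ r ≤ 1) (hy : ∀ i, |y i| ≤ δ) (hy2 : ∑ i, |y i| ^ 2 ≤ 1) :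
    |∑ i, a i * y i| ≤ δ ^ (2 / r - 1) := by
  have habs : |∑ i, a i * y i| ≤ ∑ i, |a i| * |y i| :=
    (Finset.abs_sum_le_sum_abs _ _).trans_eq (Finset.sum_congr rfl fun i _ => abs_mul _ _)
  refine habs.trans ?_
  rcases hr1.eq_or_lt with rfl | hr1
  · simp only [Real.rpow_one] at ha
    norm_num
    calc ∑ i, |a i| * |y i| ≤ ∑ i, |a i| * δ := by gcongr with i; exact hy i
      _ = (∑ i, |a i|) * δ := by rw [Finset.sum_mul]
      _ ≤ δ := mul_le_of_le_one_left hδ.le ha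
  have hc := Real.HolderConjugate.conjExponent hr1
  set q := Real.conjExponent r with hq
  have hqr : q⁻¹ = 1 - r⁻¹ := by have := hc.inv_add_inv_eq_one; linarith
  have hq0 : 0 < q := hc.symm.pos
  have hr0 : 0 < r := by linarith
  have hq2 : 2 ≤ q := by
    have h1 : q⁻¹ ≤ 2⁻¹ := by
      have : 2⁻¹ ≤ r⁻¹ := inv_anti₀ hr0 hr2
      linarith
    exact (inv_le_inv₀ hq0 two_pos).1 h1
  have h1 := Real.inner_le_Lp_mul_Lq Finset.univ (fun i => |a i|) (fun i => |y i|) hc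
  simp only [abs_abs] at h1
  have h2 : ∑ i, |y i| ^ q ≤ δ ^ (q - 2) := by
    calc ∑ i, |y i| ^ q ≤ ∑ i, δ ^ (q - 2) * |y i| ^ 2 := by
          refine Finset.sum_le_sum fun i _ => ?_
          rcases (abs_nonneg (y i)).eq_or_lt with h0 | h0
          · rw [← h0, Real.zero_rpow hq0.ne']; positivity
          · have : |y i| ^ q = |y i| ^ (q - 2) * |y i| ^ 2 := by
              rw [← Real.rpow_two, ← Real.rpow_add h0]; ring_nf
            rw [this]
            gcongr
            exact hy i
      _ = δ ^ (q - 2) * ∑ i, |y i| ^ 2 := by rw [Finset.mul_sum]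
      _ ≤ δ ^ (q - 2) := mul_le_of_le_one_right (by positivity) hy2
  have h3 : (∑ i, |a i| ^ r) ^ (1 / r) ≤ 1 := Real.rpow_le_one (by positivity) ha (by positivity)
  have h4 : (∑ i, |y i| ^ q) ^ (1 / q) ≤ δ ^ (2 / r - 1) := by
    calc (∑ i, |y i| ^ q) ^ (1 / q) ≤ (δ ^ (q - 2)) ^ (1 / q) := by gcongr
      _ = δ ^ (2 / r - 1) := by
        rw [← Real.rpow_mul hδ.le]
        congr 1
        have : (q - 2) * (1 / q) = 1 - 2 * q⁻¹ := by field_simp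
        rw [this, hqr]; ring
  refine h1.trans ((mul_le_mul h3 h4 (by positivity) zero_le_one).trans_eq (one_mul _))

open scoped Pointwise in
/-- The information complexity of ridge functions with smoothness `s + β` and directions in `ℓ_r`,
`r < 2`. The centres are the points of a grid of width `δ` with at most `δ⁻²` steps from the origin,
where the Taylor remainder `(2 δ ^ (2 / r - 1)) ^ (s + β)` is comparable to `ε`. -/
theorem infoComplexity_holderRidgeClass_le {s : ℕ} {β r ε : ℝ} (hβ : 0 < β) (hβ1 : β ≤ 1)
    (hr1 : 1 ≤ r) (hr2 : r < 2) (hε : 0 < ε) (hε1 : ε ≤ 1) (d : ℕ) :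
    infoComplexity (holderRidgeClass s β r) ε d ≤
      ((2 * d + 1) ^ ⌊(8 * 2 ^ (s + β) / ε) ^ (2 / ((2 / r - 1) * (s + β)))⌋₊ *
        (d + 1) ^ s : ℕ) := by
  classical
  have hA : 0 < s + β := by positivity
  have hσ : 0 < 2 / r - 1 := by
    rw [sub_pos, lt_div_iff₀ (by linarith)]; linarith
  set σ := 2 / r - 1 with hσdef
  set C : ℝ := 8 * 2 ^ (s + β) with hC
  have hC1 : 1 ≤ C := by
    have : (1 : ℝ) ≤ 2 ^ (s + β) := Real.one_le_rpow (by norm_num) hA.le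
    linarith
  have hC0 : 0 < C := by linarith
  set δ : ℝ := (ε / C) ^ (1 / (σ * (s + β))) with hδdef
  have hδ : 0 < δ := by positivity
  have hδ1 : δ ≤ 1 := Real.rpow_le_one (by positivity)
    (by rw [div_le_one hC0]; linarith) (by positivity)
  have hK : (δ ^ 2)⁻¹ = (C / ε) ^ (2 / (σ * (s + β))) := by
    rw [hδdef, ← Real.rpow_natCast, ← Real.rpow_mul (by positivity),
      ← Real.inv_rpow (by positivity), inv_div]
    congr 1
    push_cast
    ring
  set η : ℝ := δ ^ σ with hηdef
  have hη : 0 < η := by positivity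
  have hη1 : η ≤ 1 := Real.rpow_le_one hδ.le hδ1 hσ.le
  have hηA : η ^ (s + β) = ε / C := by
    rw [hηdef, hδdef, ← Real.rpow_mul (by positivity), ← Real.rpow_mul (by positivity)]
    have : 1 / (σ * (s + β)) * σ * (s + β) = 1 := by field_simp
    rw [← mul_assoc, this, Real.rpow_one]
  -- Shrinking the grid by the factor `1 - η` leaves room in the ball for the difference steps.
  let Z : Finset (EuclideanSpace ℝ (Fin d)) :=
    ((⌊(δ ^ 2)⁻¹⌋₊ • signedUnits d).image fun z : Fin d → ℤ =>
      (1 - η) • WithLp.toLp 2 fun i => δ * (z i : ℝ)).filter (‖·‖ ≤ 1 - η)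
  have hZcard : Z.card ≤ (2 * d + 1) ^ ⌊(δ ^ 2)⁻¹⌋₊ :=
    (Finset.card_filter_le _ _).trans (Finset.card_image_le.trans
      (Finset.card_nsmul_le.trans (Nat.pow_le_pow_left (card_signedUnits_le d) _)))
  refine (infoComplexity_holderRidgeClass_le_of_centers (η := η) (τ := 2 * η) hβ hβ1 (by linarith)
    hr2.le hη Z (fun z hz => (Finset.mem_filter.1 hz).2) ?_ ?_).trans ?_
  · intro x hx
    obtain ⟨z, hz, hz1, hz2, hz3⟩ := exists_round_vector hδ hx
    set w : EuclideanSpace ℝ (Fin d) := WithLp.toLp 2 fun i => δ * (z i : ℝ) with hw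
    refine ⟨(1 - η) • w, Finset.mem_filter.2 ⟨Finset.mem_image.2 ⟨z, mem_nsmul_signedUnits z hz,
      rfl⟩, ?_⟩, fun a ha => ?_⟩
    · rw [norm_smul, Real.norm_of_nonneg (by linarith)]
      exact mul_le_of_le_one_right (by linarith) hz3
    · have e : x - (1 - η) • w = (x - w) + η • w := by module
      rw [e, inner_add_right, inner_smul_right]
      have h1 : |inner ℝ a (x - w)| ≤ η := by
        have h2 := abs_sum_mul_le_rpow (y := fun i => x i - δ * z i) hr1 hr2.le hδ ha hz1 hz2
        have h3 : (inner ℝ a (x - w) : ℝ) = ∑ i, a i * (x i - δ * z i) := by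
          simp [PiLp.inner_apply, hw, mul_comm]
        rwa [h3]
      have h2 : |η * inner ℝ a w| ≤ η := by
        rw [abs_mul, abs_of_pos hη]
        exact mul_le_of_le_one_right hη.le
          (abs_inner_le_one (norm_le_one_of_sum_rpow_le (by linarith) hr2.le ha) hz3)
      linarith [abs_add_le (inner ℝ a (x - w)) (η * inner ℝ a w)]
  · have h1 : 4 * (2 * η) ^ (s + β) = ε / 2 := by
      rw [Real.mul_rpow (by norm_num) hη.le, hηA, hC]
      have : (0 : ℝ) < 2 ^ (s + β) := by positivity
      field_simp
      norm_num
    rw [h1]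
    have h2 : ε / 2 / s.factorial ≤ ε / 2 :=
      div_le_self (by positivity) (Nat.one_le_cast.2 s.factorial_pos)
    linarith
  · rw [← hK]
    exact_mod_cast Nat.mul_le_mul_right _ hZcard

/-! ### Binary codes -/

/-- A binary ball of radius `k` in dimension `4k` is exponentially smaller than the cube: weight
each word by `3` to the power minus its size. -/
theorem card_filter_card_lt_le (k : ℕ) :
    ((Finset.univ.filter fun W : Finset (Fin (4 * k)) => W.card < k).card : ℝ) ≤
      (256 / 27) ^ k := by
  have h1 := Fintype.sum_pow_mul_eq_add_pow (Fin (4 * k)) (1 / 3 : ℝ) 1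
  simp only [one_pow, mul_one, Fintype.card_fin] at h1
  have h2 : ((Finset.univ.filter fun W : Finset (Fin (4 * k)) => W.card < k).card : ℝ) *
      (1 / 3) ^ k ≤ (1 / 3 + 1) ^ (4 * k) := by
    rw [← h1, ← nsmul_eq_mul]
    refine (Finset.card_nsmul_le_sum _ (fun W => (1 / 3 : ℝ) ^ W.card) _ fun W hW => ?_).trans
      (Finset.sum_le_sum_of_subset_of_nonneg (Finset.subset_univ _) fun _ _ _ => by positivity)
    exact pow_le_pow_of_le_one (by norm_num) (by norm_num) (Finset.mem_filter.1 hW).2.le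
  have h3 : (256 / 27 : ℝ) ^ k = (1 / 3 + 1) ^ (4 * k) * 3 ^ k := by
    rw [pow_mul, ← mul_pow]; norm_num
  rw [h3]
  refine le_of_eq_of_le ?_ (mul_le_mul_of_nonneg_right h2 (by positivity))
  rw [mul_assoc, ← mul_pow]
  norm_num

/-- The Gilbert–Varshamov bound for relative distance one quarter. -/
theorem exists_binary_code (k : ℕ) : ∃ C : Finset (Finset (Fin (4 * k))),
    (27 / 16 : ℝ) ^ k ≤ C.card ∧ ∀ A ∈ C, ∀ B ∈ C, A ≠ B → k ≤ (symmDiff A B).card := by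
  classical
  rcases Nat.eq_zero_or_pos k with rfl | hk
  · exact ⟨{∅}, by simp, by simp⟩
  obtain ⟨C, hC, hmax⟩ := Finset.exists_max_image
    (Finset.univ.filter fun C : Finset (Finset (Fin (4 * k))) =>
      ∀ A ∈ C, ∀ B ∈ C, A ≠ B → k ≤ (symmDiff A B).card) Finset.card ⟨∅, by simp⟩
  rw [Finset.mem_filter] at hC
  refine ⟨C, ?_, hC.2⟩
  -- A code of maximal size is a covering of radius less than `k`.
  have hcov : ∀ A : Finset (Fin (4 * k)), ∃ B ∈ C, (symmDiff A B).card < k := by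
    intro A
    by_contra! hcon
    have hA : A ∉ C := fun hA => by
      have := hcon A hA
      simp at this
      omega
    have := hmax (insert A C) (by
      rw [Finset.mem_filter]
      refine ⟨Finset.mem_univ _, fun B hB B' hB' hne => ?_⟩
      rw [Finset.mem_insert] at hB hB'
      rcases hB with rfl | hB <;> rcases hB' with rfl | hB'
      · exact absurd rfl hne
      · exact hcon _ hB'
      · rw [symmDiff_comm]; exact hcon _ hB
      · exact hC.2 _ hB _ hB' hne)
    rw [Finset.card_insert_of_notMem hA] at this
    omega
  set V := Finset.univ.filter fun W : Finset (Fin (4 * k)) => W.card < k with hV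
  have hcount : 2 ^ (4 * k) ≤ C.card * V.card := by
    have h1 : (Finset.univ : Finset (Finset (Fin (4 * k)))) ⊆
        (C ×ˢ V).image fun q => symmDiff q.2 q.1 := fun A _ => by
      obtain ⟨B, hB, hAB⟩ := hcov A
      exact Finset.mem_image.2 ⟨(B, symmDiff A B), Finset.mem_product.2
        ⟨hB, Finset.mem_filter.2 ⟨Finset.mem_univ _, hAB⟩⟩, symmDiff_symmDiff_cancel_right _ _⟩
    have h2 := (Finset.card_le_card h1).trans Finset.card_image_le
    simpa using h2
  have h2 : (2 : ℝ) ^ (4 * k) ≤ C.card * (256 / 27) ^ k := by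
    calc (2 : ℝ) ^ (4 * k) ≤ C.card * V.card := by exact_mod_cast hcount
      _ ≤ _ := by gcongr; exact card_filter_card_lt_le k
  have h3 : (2 : ℝ) ^ (4 * k) = (27 / 16) ^ k * (256 / 27) ^ k := by
    rw [pow_mul, ← mul_pow]; norm_num
  rw [h3] at h2
  exact le_of_mul_le_mul_right h2 (by positivity)

/-- The vector with entries `c` on `A` and `-c` off `A`. -/
noncomputable def signVector {d : ℕ} (c : ℝ) (A : Finset (Fin d)) : EuclideanSpace ℝ (Fin d) :=
  WithLp.toLp 2 fun i => if i ∈ A then c else -c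

theorem abs_signVector_apply {d : ℕ} {c : ℝ} (hc : 0 ≤ c) (A : Finset (Fin d)) (i : Fin d) :
    |signVector c A i| = c := by
  simp only [signVector]
  split_ifs <;> simp [abs_of_nonneg hc]

theorem norm_sq_signVector {d : ℕ} {c : ℝ} (hc : 0 ≤ c) (A : Finset (Fin d)) :
    ‖signVector c A‖ ^ 2 = d * c ^ 2 := by
  rw [EuclideanSpace.real_norm_sq_eq]
  simp_rw [← sq_abs (signVector c A _), abs_signVector_apply hc]
  simp

theorem norm_sq_signVector_add {d : ℕ} (c : ℝ) (A B : Finset (Fin d)) :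
    ‖signVector c A + signVector c B‖ ^ 2 = 4 * c ^ 2 * (d - (symmDiff A B).card) := by
  rw [EuclideanSpace.real_norm_sq_eq]
  have h1 : ∀ i, (signVector c A + signVector c B) i ^ 2 =
      4 * c ^ 2 - if i ∈ symmDiff A B then 4 * c ^ 2 else 0 := by
    intro i
    simp only [PiLp.add_apply, signVector, Finset.mem_symmDiff]
    by_cases hA : i ∈ A <;> by_cases hB : i ∈ B <;> simp [hA, hB] <;> ring
  simp_rw [h1]
  rw [Finset.sum_sub_distrib, Finset.sum_ite_mem]
  simp
  ring

/-! ### Bump profiles -/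

/-- A smooth bump around one, supported in `[9/10, 11/10]`. -/
noncomputable def unitBump : ContDiffBump (1 : ℝ) where
  rIn := 1 / 20
  rOut := 1 / 10
  rIn_pos := by norm_num
  rIn_lt_rOut := by norm_num

theorem lt_of_unitBump_ne_zero {t : ℝ} (h : unitBump t ≠ 0) : 9 / 10 < t := by
  have h1 : t ∈ Function.support unitBump := h
  rw [unitBump.support_eq, Metric.mem_ball, Real.dist_eq, abs_lt] at h1
  have : unitBump.rOut = 1 / 10 := rfl
  linarith [h1.1]

theorem unitBump_eq_one {t : ℝ} (h : |t - 1| ≤ 1 / 20) : unitBump t = 1 :=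
  unitBump.one_of_mem_closedBall (by rw [Metric.mem_closedBall, Real.dist_eq]; exact h)

theorem exists_bound_iteratedDeriv_unitBump (n : ℕ) :
    ∃ M : ℝ, 1 ≤ M ∧ ∀ k ≤ n, ∀ t, |iteratedDeriv k unitBump t| ≤ M := by
  have h1 : ∀ k : ℕ, ∃ M : ℝ, ∀ t, |iteratedDeriv k unitBump t| ≤ M := fun k => by
    have hc : Continuous (iteratedFDeriv ℝ k unitBump) :=
      (unitBump.contDiff (n := (k : ℕ∞))).continuous_iteratedFDeriv le_rfl
    obtain ⟨M, hM⟩ := (unitBump.hasCompactSupport.iteratedFDeriv (𝕜 := ℝ)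
      k).exists_bound_of_continuous hc
    exact ⟨M, fun t => by
      rw [← Real.norm_eq_abs, ← norm_iteratedFDeriv_eq_norm_iteratedDeriv]; exact hM t⟩
  choose M hM using h1
  refine ⟨1 + ∑ k ∈ Finset.range (n + 1), |M k|, by
    linarith [Finset.sum_nonneg fun k (_ : k ∈ Finset.range (n + 1)) => abs_nonneg (M k)],
    fun k hk t => ?_⟩
  have h2 := Finset.single_le_sum (f := fun k => |M k|) (fun _ _ => abs_nonneg _)
    (Finset.mem_range.2 (Nat.lt_succ_of_le hk))
  linarith [hM k t, le_abs_self (M k)]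

/-- The bump rescaled to width `R` has norm of order `R ^ (-α)`, so that a multiple of order `R ^ α`
lies in the unit ball of the Lipschitz space of order `α`. -/
theorem exists_inProfileBall_bump {α : ℝ≥0∞} (hα : 0 < α) (hα' : α < ⊤) :
    ∃ c : ℝ, 0 < c ∧ c ≤ 1 ∧ ∀ R : ℝ, 0 < R → R ≤ 1 →
      InProfileBall α fun t => c * R ^ α.toReal * unitBump (R⁻¹ * t) := by
  have hpos : 0 < α.toReal := ENNReal.toReal_pos hα.ne' hα'.ne
  set A := α.toReal with hA
  set s := strictFloor A with hs
  have hβ : 0 < A - s := sub_pos.2 (strictFloor_lt hpos)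
  have hβ1 : A - s ≤ 1 := sub_strictFloor_le_one A
  obtain ⟨M, hM1, hM⟩ := exists_bound_iteratedDeriv_unitBump (s + 1)
  have hM0 : 0 < M := by linarith
  refine ⟨M⁻¹, by positivity, inv_le_one_of_one_le₀ hM1, fun R hR hR1 => ?_⟩
  have hsm : ∀ n : ℕ, ContDiff ℝ n fun t => unitBump (R⁻¹ * t) := fun n =>
    (unitBump.contDiff (n := (n : ℕ∞))).comp (contDiff_const.mul contDiff_id)
  have hder : ∀ k : ℕ, ∀ t ∈ profileInterval,
      iteratedDerivWithin k (fun t => M⁻¹ * R ^ A * unitBump (R⁻¹ * t)) profileInterval t =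
        M⁻¹ * R ^ A * (R⁻¹ ^ k * iteratedDeriv k unitBump (R⁻¹ * t)) := fun k t ht => by
    rw [iteratedDerivWithin_eq_iteratedDeriv uniqueDiffOn_profileInterval
      (contDiff_const.mul (hsm k)).contDiffAt ht, iteratedDeriv_const_mul _ (hsm k).contDiffAt,
      iteratedDeriv_comp_const_mul unitBump.contDiff]
  have hRk : ∀ k ≤ s, R ^ A * R⁻¹ ^ k ≤ 1 := fun k hk => by
    rw [inv_pow, ← Real.rpow_natCast, ← Real.rpow_neg hR.le, ← Real.rpow_add hR]
    refine Real.rpow_le_one hR.le hR1 ?_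
    have : (k : ℝ) ≤ s := by exact_mod_cast hk
    linarith
  rw [InProfileBall, if_neg hα'.ne]
  refine ⟨(contDiff_const.mul (hsm s)).contDiffOn, max_le ?_ ?_⟩
  · refine iSup₂_le fun k hk => iSup₂_le fun t ht => ?_
    rw [hder k t ht, ← ofReal_norm, ENNReal.ofReal_le_one, Real.norm_eq_abs]
    have h1 := hM k (hk.trans (Nat.le_succ s)) (R⁻¹ * t)
    have h2 : M⁻¹ * R ^ A * (R⁻¹ ^ k * iteratedDeriv k unitBump (R⁻¹ * t)) =
        (R ^ A * R⁻¹ ^ k) * (M⁻¹ * iteratedDeriv k unitBump (R⁻¹ * t)) := by ring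
    rw [h2, abs_mul, abs_of_nonneg (by positivity : 0 ≤ R ^ A * R⁻¹ ^ k)]
    refine mul_le_one₀ (hRk k hk) (abs_nonneg _) ?_
    rw [abs_mul, abs_of_pos (inv_pos.2 hM0), inv_mul_le_one₀ hM0]
    exact h1
  · refine iSup₂_le fun x hx => iSup₂_le fun y hy => iSup_le fun hxy => ?_
    have hD : 0 < |x - y| := abs_pos.2 (sub_ne_zero.2 hxy)
    rw [ENNReal.ofReal_le_one, div_le_one (by positivity), hder s x hx, hder s y hy]
    set D := |x - y| with hDdef
    -- At distance `D / R` the derivative of the bump oscillates by at most `2 M` and `M D / R`.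
    have h1 : |iteratedDeriv s unitBump (R⁻¹ * x) - iteratedDeriv s unitBump (R⁻¹ * y)| ≤
        2 * M * min 1 (R⁻¹ * D) := by
      have ha : |iteratedDeriv s unitBump (R⁻¹ * x) - iteratedDeriv s unitBump (R⁻¹ * y)| ≤
          2 * M := by
        have h1 := hM s (Nat.le_succ s) (R⁻¹ * x)
        have h2 := hM s (Nat.le_succ s) (R⁻¹ * y)
        rw [abs_le] at h1 h2 ⊢
        constructor <;> linarith [h1.1, h1.2, h2.1, h2.2]
      have hb : |iteratedDeriv s unitBump (R⁻¹ * x) - iteratedDeriv s unitBump (R⁻¹ * y)| ≤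
          M * |R⁻¹ * x - R⁻¹ * y| := by
        have hdiff : Differentiable ℝ (iteratedDeriv s unitBump) :=
          (unitBump.contDiff (n := ((s + 1 : ℕ) : ℕ∞))).differentiable_iteratedDeriv s
            (by exact_mod_cast Nat.lt_succ_self s)
        have := convex_univ.norm_image_sub_le_of_norm_deriv_le (f := iteratedDeriv s unitBump)
          (C := M) (fun t _ => hdiff t)
          (fun t _ => by rw [← iteratedDeriv_succ]; exact hM (s + 1) le_rfl t)
          (Set.mem_univ (R⁻¹ * y)) (Set.mem_univ (R⁻¹ * x))
        simpa using this
      rw [← mul_sub, abs_mul, abs_of_pos (inv_pos.2 hR)] at hb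
      rw [mul_min_of_nonneg _ _ (by positivity)]
      refine le_min (by linarith) (hb.trans ?_)
      have : 0 ≤ M * (R⁻¹ * D) := by positivity
      linarith
    have h2 : min 1 (R⁻¹ * D) ≤ (min 1 (R⁻¹ * D)) ^ (A - s) := by
      simpa using Real.rpow_le_rpow_of_exponent_ge (lt_min one_pos (by positivity))
        (min_le_left _ _) hβ1
    have h3 : R ^ A * R⁻¹ ^ s * (min 1 (R⁻¹ * D)) ^ (A - s) ≤ (min 1 D) ^ (A - s) := by
      rw [inv_pow, ← Real.rpow_natCast, ← Real.rpow_neg hR.le, ← Real.rpow_add hR,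
        ← sub_eq_add_neg, ← Real.mul_rpow hR.le (by positivity)]
      refine Real.rpow_le_rpow (by positivity) ?_ hβ.le
      rw [mul_min_of_nonneg _ _ hR.le, mul_one, mul_inv_cancel_left₀ hR.ne']
      exact min_le_min_right _ hR1
    have h4 : M⁻¹ * R ^ A * (R⁻¹ ^ s * iteratedDeriv s unitBump (R⁻¹ * x)) -
        M⁻¹ * R ^ A * (R⁻¹ ^ s * iteratedDeriv s unitBump (R⁻¹ * y)) =
        (M⁻¹ * (R ^ A * R⁻¹ ^ s)) *
          (iteratedDeriv s unitBump (R⁻¹ * x) - iteratedDeriv s unitBump (R⁻¹ * y)) := by ring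
    rw [h4, abs_mul, abs_of_nonneg (by positivity : 0 ≤ M⁻¹ * (R ^ A * R⁻¹ ^ s))]
    calc _ ≤ M⁻¹ * (R ^ A * R⁻¹ ^ s) * (2 * M * (min 1 (R⁻¹ * D)) ^ (A - s)) := by
          gcongr
          exact h1.trans (by gcongr)
      _ = 2 * (R ^ A * R⁻¹ ^ s * (min 1 (R⁻¹ * D)) ^ (A - s)) := by field_simp
      _ ≤ _ := by gcongr

/-! ### Lower bounds -/

/-- A function with modulus at least `r` on an open subset of the ball has `L_∞`-norm at
least `r`. -/
theorem le_eLpNorm_top_of_isOpen {d : ℕ} {f : UnitBall d → ℝ} {r : ℝ≥0∞}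
    {U : Set (EuclideanSpace ℝ (Fin d))} (hU : IsOpen U) (hne : U.Nonempty)
    (hUb : U ⊆ Metric.closedBall 0 1) (hf : ∀ x : UnitBall d, (x : EuclideanSpace ℝ (Fin d)) ∈ U →
      r ≤ ‖f x‖ₑ) : r ≤ eLpNorm f ⊤ (ballMeasure d) := by
  by_contra! hlt
  rw [eLpNorm_exponent_top, eLpNormEssSup] at hlt
  have h1 := ae_lt_of_essSup_lt hlt
  rw [ae_iff] at h1
  have h2 : ballMeasure d (Subtype.val ⁻¹' U) = 0 :=
    measure_mono_null (fun x hx => not_lt.2 (hf x hx)) h1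
  rw [ballMeasure, (MeasurableEmbedding.subtype_coe Metric.isClosed_closedBall.measurableSet
    ).comap_apply, Subtype.image_preimage_coe, Set.inter_eq_right.2 hUb] at h2
  exact (hU.measure_pos volume hne).ne' h2

/-- Exponentially many ridge functions with disjoint supports: their directions are sign vectors
coming from a binary code, and their profiles are bumps seeing only the caps of the ball around the
directions. -/
theorem exists_le_infoComplexity_ridgeClass {α : ℝ≥0∞} {p : ℝ} (hα : 0 < α) (hα' : α < ⊤)
    (hp0 : 0 < p) (hp2 : p ≤ 2) :
    ∃ c : ℝ, 0 < c ∧ c ≤ 1 ∧ ∀ k : ℕ, 1 ≤ k → ∀ ε : ℝ,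
      ε < c * ((4 * k : ℕ) : ℝ) ^ ((1 / 2 - 1 / p) * α.toReal) →
      ENNReal.ofReal ((27 / 16) ^ k) ≤ (infoComplexity (ridgeClass α p) ε (4 * k) : ℝ≥0∞) := by
  obtain ⟨c, hc, hc1, hball⟩ := exists_inProfileBall_bump hα hα'
  refine ⟨c, hc, hc1, fun k hk ε hε => ?_⟩
  set d : ℕ := 4 * k with hd
  have hd0 : (0 : ℝ) < d := by exact_mod_cast (by omega : 0 < d)
  have hd1 : (1 : ℝ) ≤ d := by exact_mod_cast (by omega : 1 ≤ d)
  set R : ℝ := (d : ℝ) ^ (1 / 2 - 1 / p) with hR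
  have hR0 : 0 < R := by positivity
  have hR1 : R ≤ 1 := Real.rpow_le_one_of_one_le_of_nonpos hd1 (by
    rw [sub_nonpos]; exact one_div_le_one_div_of_le hp0 hp2)
  set b : ℝ := (d : ℝ) ^ (-(1 / p)) with hb
  have hb0 : 0 < b := by positivity
  have hRb : R ^ 2 = d * b ^ 2 := by
    have e : (d : ℝ) ^ ((1 : ℝ) / 2) * b = R := by
      rw [hb, hR, ← Real.rpow_add hd0, sub_eq_add_neg]
    rw [← e, mul_pow, ← Real.sqrt_eq_rpow, Real.sq_sqrt hd0.le]
  have hlp : ∀ A : Finset (Fin d), lpQuasiNorm p (signVector b A) ≤ 1 := fun A => by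
    have h1 : b ^ p = (d : ℝ)⁻¹ := by
      rw [hb, ← Real.rpow_mul hd0.le]
      have : -(1 / p) * p = -1 := by field_simp
      rw [this, Real.rpow_neg_one]
    have h2 : ∑ i, |signVector b A i| ^ p = 1 := by
      calc ∑ i, |signVector b A i| ^ p = ∑ _i : Fin d, (d : ℝ)⁻¹ :=
            Finset.sum_congr rfl fun i _ =>
              (congrArg (· ^ p) (abs_signVector_apply hb0.le A i)).trans h1
        _ = 1 := by simp [hd0.ne']
    rw [lpQuasiNorm, h2, Real.one_rpow]
  have hnorm : ∀ A : Finset (Fin d), ‖signVector b A‖ = R := fun A => by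
    have := norm_sq_signVector hb0.le A
    rw [← hRb] at this
    exact (pow_left_inj₀ (norm_nonneg _) hR0.le two_ne_zero).1 this
  obtain ⟨C, hCcard, hC⟩ := exists_binary_code k
  let f : Finset (Fin d) → UnitBall d → ℝ := fun A x =>
    c * R ^ α.toReal * unitBump (R⁻¹ * inner ℝ (signVector b A) (x : EuclideanSpace ℝ (Fin d)))
  have hcap : ∀ A (x : UnitBall d), f A x ≠ 0 → 9 / 10 * R < inner ℝ (signVector b A)
      (x : EuclideanSpace ℝ (Fin d)) := fun A x hx => by
    have := lt_of_unitBump_ne_zero (right_ne_zero_of_mul hx)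
    rwa [inv_mul_eq_div, lt_div_iff₀ hR0] at this
  have key := card_le_infoComplexity_of_fooling (F := ridgeClass α p) (d := d) (A := C) (f := f)
    (r := ENNReal.ofReal (c * R ^ α.toReal)) (ε := ε)
    (fun A _ => ⟨_, signVector b A, hball R hR0 hR1, hlp A, fun x => rfl⟩) ?_ ?_ ?_
  · calc ENNReal.ofReal ((27 / 16) ^ k) ≤ ENNReal.ofReal C.card := ENNReal.ofReal_le_ofReal hCcard
      _ = ((C.card : ℕ∞) : ℝ≥0∞) := by simp
      _ ≤ _ := by exact_mod_cast key
  · intro A hA B hB x hxA hxB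
    by_contra hne
    -- A common point of two caps would give `9/5 * R < ‖a + b‖ ≤ √3 * R`.
    have h1 := hcap A x hxA
    have h2 := hcap B x hxB
    have h3 : inner ℝ (signVector b A + signVector b B) (x : EuclideanSpace ℝ (Fin d)) ≤
        ‖signVector b A + signVector b B‖ :=
      (real_inner_le_norm _ _).trans
        (mul_le_of_le_one_right (norm_nonneg _) (mem_closedBall_zero_iff.1 x.2))
    rw [inner_add_left] at h3
    have h4 : ‖signVector b A + signVector b B‖ ^ 2 ≤ 3 * R ^ 2 := by
      rw [norm_sq_signVector_add, hRb]
      have h5 : (k : ℝ) ≤ (symmDiff A B).card := by exact_mod_cast hC A hA B hB hne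
      have h6 : (d : ℝ) = 4 * k := by rw [hd]; push_cast; ring
      rw [h6]
      nlinarith [sq_nonneg b]
    nlinarith
  · intro A _
    refine le_eLpNorm_top_of_isOpen (U := Metric.ball 0 1 ∩
      {y | |R⁻¹ * inner ℝ (signVector b A) y - 1| < 1 / 20}) ?_ ?_ ?_ ?_
    · refine Metric.isOpen_ball.inter (isOpen_lt (by fun_prop) continuous_const)
    · refine ⟨(39 / 40 * R⁻¹) • signVector b A, ?_, ?_⟩
      · rw [mem_ball_zero_iff, norm_smul, hnorm, Real.norm_of_nonneg (by positivity)]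
        field_simp
        norm_num
      · rw [Set.mem_ofPred_eq, inner_smul_right, real_inner_self_eq_norm_sq, hnorm]
        have : R⁻¹ * (39 / 40 * R⁻¹ * R ^ 2) = 39 / 40 := by field_simp
        rw [this]; norm_num [abs_lt]
    · exact Set.inter_subset_left.trans Metric.ball_subset_closedBall
    · intro x hx
      rw [← ofReal_norm]
      refine ENNReal.ofReal_le_ofReal ?_
      simp only [f]
      rw [unitBump_eq_one hx.2.le, mul_one]
      exact le_abs_self _
  · rw [hR, ← Real.rpow_mul hd0.le]
    exact (ENNReal.ofReal_lt_ofReal_iff (by positivity)).2 hε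

/-! ### Adaptive recovery of the direction -/

/-- Ridge functions with a differentiable Hölder profile whose derivative at the origin is at least
`κ` in absolute value. -/
def holderRidgeClassDeriv (s : ℕ) (β κ : ℝ) (d : ℕ) : Set (UnitBall d → ℝ) :=
  {f | ∃ (g : ℝ → ℝ) (a : EuclideanSpace ℝ (Fin d)), IsHolderProfile s β g ∧ ‖a‖ ≤ 1 ∧
    κ ≤ |deriv g 0| ∧ ∀ x : UnitBall d, f x = g (inner ℝ a (x : EuclideanSpace ℝ (Fin d)))}

open Classical in
/-- A vector regarded as a point of the unit ball, with the origin replacing vectors outside. -/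
noncomputable def toUnitBall {d : ℕ} (v : EuclideanSpace ℝ (Fin d)) : UnitBall d :=
  if h : v ∈ Metric.closedBall 0 1 then ⟨v, h⟩ else ⟨0, by simp⟩

theorem coe_toUnitBall {d : ℕ} {v : EuclideanSpace ℝ (Fin d)} (h : ‖v‖ ≤ 1) :
    (toUnitBall v : EuclideanSpace ℝ (Fin d)) = v := by
  rw [toUnitBall, dif_pos (mem_closedBall_zero_iff.2 h)]

/-- The normalisation of a vector; the zero vector is left alone. -/
noncomputable def unitDirection {d : ℕ} (c : EuclideanSpace ℝ (Fin d)) :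
    EuclideanSpace ℝ (Fin d) := ‖c‖⁻¹ • c

theorem norm_unitDirection_le {d : ℕ} (c : EuclideanSpace ℝ (Fin d)) : ‖unitDirection c‖ ≤ 1 := by
  rw [unitDirection, norm_smul, norm_inv, norm_norm]
  exact inv_mul_le_one

theorem norm_smul_unitDirection {d : ℕ} (c : EuclideanSpace ℝ (Fin d)) :
    ‖c‖ • unitDirection c = c := by
  rcases eq_or_ne c 0 with rfl | h
  · simp [unitDirection]
  · rw [unitDirection, smul_inv_smul₀ (norm_ne_zero_iff.2 h)]

/-- The forward differences of `f` at the origin along the coordinate directions. -/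
noncomputable def originDiff {d : ℕ} (h : ℝ) (f : UnitBall d → ℝ) : EuclideanSpace ℝ (Fin d) :=
  WithLp.toLp 2 fun i => f (toUnitBall (EuclideanSpace.single i h)) - f (toUnitBall 0)

/-- The sampling points of the two-stage algorithm: first the origin and the points `h e_i`, then
`2M + 1` equidistant points on the segment spanned by the normalised difference vector. -/
noncomputable def twoStagePoint (d M : ℕ) (h : ℝ) (k : ℕ) (y : Fin k → ℝ) : UnitBall d :=
  if hk : d + 1 ≤ k then
    toUnitBall (((((k - (d + 1) : ℕ) : ℝ) - (M : ℝ)) / (M : ℝ)) •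
      unitDirection (WithLp.toLp 2 fun i : Fin d =>
        y ⟨i + 1, by omega⟩ - y ⟨0, by omega⟩))
  else if hk0 : k = 0 then toUnitBall 0
  else toUnitBall (EuclideanSpace.single ⟨k - 1, by omega⟩ h)

theorem twoStagePoint_zero {d M : ℕ} {h : ℝ} (y : Fin 0 → ℝ) :
    twoStagePoint d M h 0 y = toUnitBall 0 := by
  simp [twoStagePoint]

theorem twoStagePoint_succ {d M : ℕ} {h : ℝ} (i : Fin d) (y : Fin (i + 1) → ℝ) :
    twoStagePoint d M h (i + 1) y = toUnitBall (EuclideanSpace.single i h) := by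
  rw [twoStagePoint, dif_neg (by omega), dif_neg (by omega)]
  simp

theorem twoStagePoint_sampleValues {d M : ℕ} {h : ℝ} (f : UnitBall d → ℝ) (j : ℕ) :
    twoStagePoint d M h (d + 1 + j) (sampleValues (twoStagePoint d M h) f (d + 1 + j)) =
      toUnitBall ((((j : ℝ) - (M : ℝ)) / (M : ℝ)) • unitDirection (originDiff h f)) := by
  rw [twoStagePoint, dif_pos (by omega), Nat.add_sub_cancel_left, originDiff]
  simp only [sampleValues_apply, twoStagePoint_succ, twoStagePoint_zero]

theorem originDiff_eq_of_sampleValues_eq {d M m : ℕ} {h : ℝ} {f f' : UnitBall d → ℝ}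
    (hm : d + 1 ≤ m)
    (hff : sampleValues (twoStagePoint d M h) f m = sampleValues (twoStagePoint d M h) f' m) :
    originDiff h f = originDiff h f' := by
  have h0 := apply_point_eq_of_sampleValues_eq hff (k := 0) (by omega)
  rw [twoStagePoint_zero] at h0
  rw [originDiff, originDiff]
  congr 1
  ext i
  have h1 := apply_point_eq_of_sampleValues_eq hff (k := i + 1) (by omega)
  rw [twoStagePoint_succ] at h1
  rw [h0, h1]

/-- The difference vector is nearly proportional to the direction of the ridge. -/
theorem norm_originDiff_sub_le {d s : ℕ} {β h : ℝ} {g : ℝ → ℝ} (hβ : 0 < β) (hβ1 : β ≤ 1)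
    (hs : 1 ≤ s) (hg : IsHolderProfile s β g) {a : EuclideanSpace ℝ (Fin d)} (ha : ‖a‖ ≤ 1)
    (hh : 0 < h) (hsh : s * h < 1) {f : UnitBall d → ℝ}
    (hf : ∀ x : UnitBall d, f x = g (inner ℝ a (x : EuclideanSpace ℝ (Fin d)))) :
    ‖originDiff h f - (h * deriv g 0) • a‖ ≤ h * (2 * (s * h) ^ β) := by
  have h0mem : (0 : ℝ) ∈ profileInterval := mem_profileInterval.2 (by simp)
  have hderiv : deriv g 0 = iteratedDerivWithin 1 g profileInterval 0 := by
    rw [iteratedDerivWithin_one, derivWithin_of_mem_nhds]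
    exact Icc_mem_nhds (by norm_num) (by norm_num)
  have hs1 : (1 : ℝ) ≤ s := by exact_mod_cast hs
  have hh1 : h ≤ 1 := by nlinarith
  have hcoord : ∀ i, |(originDiff h f - (h * deriv g 0) • a) i| ≤
      h * (2 * (s * h) ^ β) * |a i| := by
    intro i
    obtain ⟨ξ, hξI, hξ, hE⟩ := exists_mixedDiff_ridge_eq hg ha hh.le (x₀ := 0)
      (by simpa using hsh) hs (fun _ : Fin 1 => i)
    simp only [List.ofFn_succ, List.ofFn_zero, mixedDiff, zero_add, inner_zero_right, sub_zero,
      Finset.univ_unique, Finset.prod_const, Finset.card_singleton, pow_one] at hE hξ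
    have h1 : (originDiff h f - (h * deriv g 0) • a) i =
        h * a i * (iteratedDerivWithin 1 g profileInterval ξ -
          iteratedDerivWithin 1 g profileInterval 0) := by
      simp only [PiLp.sub_apply, PiLp.smul_apply, originDiff, hf, hderiv, smul_eq_mul]
      rw [coe_toUnitBall (by simpa [abs_of_pos hh] using hh1), coe_toUnitBall (by simp),
        inner_zero_right, hE]
      ring
    have h2 := hg.abs_sub_le hβ1 hs hξI h0mem (by rw [sub_zero]; linarith)
    rw [sub_zero] at h2
    rw [h1, abs_mul, abs_mul, abs_of_pos hh]
    have h3 : |ξ| ^ β ≤ (s * h) ^ β := Real.rpow_le_rpow (abs_nonneg _) hξ hβ.le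
    calc _ ≤ h * |a i| * (2 * (s * h) ^ β) := by gcongr; linarith
      _ = _ := by ring
  have hω : 0 ≤ h * (2 * (s * h) ^ β) := by positivity
  have h4 : ‖originDiff h f - (h * deriv g 0) • a‖ ≤ ‖(h * (2 * (s * h) ^ β)) • a‖ := by
    rw [EuclideanSpace.norm_eq, EuclideanSpace.norm_eq]
    refine Real.sqrt_le_sqrt (Finset.sum_le_sum fun i _ => ?_)
    have := hcoord i
    rw [Real.norm_eq_abs, Real.norm_eq_abs, PiLp.smul_apply, smul_eq_mul, abs_mul,
      abs_of_nonneg hω]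
    exact pow_le_pow_left₀ (abs_nonneg _) this 2
  refine h4.trans ?_
  rw [norm_smul, Real.norm_of_nonneg hω]
  exact mul_le_of_le_one_right hω ha

/-- Replacing `x` by its projection onto the recovered direction changes a ridge function little,
since the functional `a - ⟪a, u⟫ u` vanishes for `a` parallel to `u`. -/
theorem abs_sub_apply_line_le {d s : ℕ} {β h κ ω t η : ℝ} (hβ : 0 < β) (hβ1 : β ≤ 1)
    (hs : 1 ≤ s) (hκ : 0 < κ) (hh : 0 < h) (hsh : s * h < 1) (hω : 2 * (s * h) ^ β ≤ ω * κ)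
    {f : UnitBall d → ℝ} (hf : f ∈ holderRidgeClassDeriv s β κ d) (x : UnitBall d)
    (ht : |t| ≤ 1) (hη : |inner ℝ (unitDirection (originDiff h f))
      (x : EuclideanSpace ℝ (Fin d)) - t| ≤ η) :
    |f x - f (toUnitBall (t • unitDirection (originDiff h f)))| ≤ 2 * ω + η := by
  obtain ⟨g, a, hg, ha, hgκ, hf⟩ := hf
  have h1 := norm_originDiff_sub_le hβ hβ1 hs hg ha hh hsh hf
  set c := originDiff h f with hc
  set u := unitDirection c with hu
  have hu1 : ‖u‖ ≤ 1 := norm_unitDirection_le c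
  have hx : ‖(x : EuclideanSpace ℝ (Fin d))‖ ≤ 1 := mem_closedBall_zero_iff.1 x.2
  have hD : deriv g 0 ≠ 0 := fun h0 => by rw [h0, abs_zero] at hgκ; linarith
  have hhD : h * deriv g 0 ≠ 0 := mul_ne_zero hh.ne' hD
  set e := a - (h * deriv g 0)⁻¹ • c with he
  have he1 : ‖e‖ ≤ ω := by
    have h2 : e = -((h * deriv g 0)⁻¹ • (c - (h * deriv g 0) • a)) := by
      rw [smul_sub, inv_smul_smul₀ hhD, he]; abel
    rw [h2, norm_neg, norm_smul, norm_inv, Real.norm_eq_abs, abs_mul, abs_of_pos hh,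
      inv_mul_le_iff₀ (by positivity)]
    have hω0 : 0 ≤ ω := by
      have : 0 ≤ ω * κ := le_trans (by positivity) hω
      exact nonneg_of_mul_nonneg_left this hκ
    calc _ ≤ h * (2 * (s * h) ^ β) := h1
      _ ≤ h * (ω * κ) := by gcongr
      _ ≤ h * (ω * |deriv g 0|) := by gcongr
      _ = _ := by ring
  have htu : ‖t • u‖ ≤ 1 := by
    rw [norm_smul]; exact mul_le_one₀ ht (norm_nonneg _) hu1
  rw [hf, hf, coe_toUnitBall htu]
  refine (hg.abs_apply_sub_le hs (mem_profileInterval.2 (abs_inner_le_one ha hx))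
    (mem_profileInterval.2 (abs_inner_le_one ha htu))).trans ?_
  have hau : ∀ y : EuclideanSpace ℝ (Fin d), inner ℝ a y =
      (inner ℝ e y : ℝ) + (h * deriv g 0)⁻¹ * (‖c‖ * inner ℝ u y) := fun y => by
    rw [he, inner_sub_left, real_inner_smul_left]
    conv_rhs => rw [← real_inner_smul_left u y ‖c‖, hu, norm_smul_unitDirection]
    ring
  have huu : ‖c‖ * inner ℝ u u = ‖c‖ := by
    rw [← real_inner_smul_left, hu, norm_smul_unitDirection, unitDirection, inner_smul_right,
      real_inner_self_eq_norm_sq]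
    rcases eq_or_ne ‖c‖ 0 with h0 | h0
    · simp [h0]
    · field_simp
  have hkey : (inner ℝ a (x : EuclideanSpace ℝ (Fin d)) : ℝ) - inner ℝ a (t • u) =
      inner ℝ e (x : EuclideanSpace ℝ (Fin d)) -
        inner ℝ u (x : EuclideanSpace ℝ (Fin d)) * inner ℝ e u +
        (inner ℝ u (x : EuclideanSpace ℝ (Fin d)) - t) * inner ℝ a u := by
    rw [inner_smul_right, hau x, hau u, huu]
    ring
  have hb1 : |inner ℝ e (x : EuclideanSpace ℝ (Fin d))| ≤ ω :=
    (abs_real_inner_le_norm _ _).trans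
      ((mul_le_of_le_one_right (norm_nonneg _) hx).trans he1)
  have hb2 : |inner ℝ u (x : EuclideanSpace ℝ (Fin d)) * inner ℝ e u| ≤ ω := by
    rw [abs_mul]
    refine (mul_le_of_le_one_left (abs_nonneg _) (abs_inner_le_one hu1 hx)).trans ?_
    exact (abs_real_inner_le_norm _ _).trans
      ((mul_le_of_le_one_right (norm_nonneg _) hu1).trans he1)
  have hb3 : |(inner ℝ u (x : EuclideanSpace ℝ (Fin d)) - t) * inner ℝ a u| ≤ η := by
    rw [abs_mul]
    exact (mul_le_of_le_one_right (abs_nonneg _) (abs_inner_le_one ha hu1)).trans hη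
  rw [hkey]
  rw [abs_le] at hb1 hb2 hb3 ⊢
  constructor <;> linarith [hb1.1, hb1.2, hb2.1, hb2.2, hb3.1, hb3.2]

theorem exists_grid_point {M : ℕ} (hM : 1 ≤ M) {r : ℝ} (hr : |r| ≤ 1) :
    ∃ j : ℕ, j < 2 * M + 1 ∧ |((j : ℝ) - M) / M| ≤ 1 ∧ |r - ((j : ℝ) - M) / M| ≤ 1 / M := by
  have hM0 : (0 : ℝ) < M := by exact_mod_cast hM
  rw [abs_le] at hr
  have hnn : 0 ≤ (r + 1) * M := mul_nonneg (by linarith) hM0.le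
  have h1 := Nat.floor_le hnn
  have h2 := (Nat.lt_floor_add_one ((r + 1) * M)).le
  have h3 : (⌊(r + 1) * M⌋₊ : ℝ) ≤ 2 * M := h1.trans (by gcongr; linarith)
  refine ⟨⌊(r + 1) * M⌋₊, ?_, ?_, ?_⟩
  · have : ⌊(r + 1) * M⌋₊ ≤ 2 * M := by exact_mod_cast h3
    omega
  · rw [abs_div, abs_of_pos hM0, div_le_one hM0, abs_le]
    constructor <;> linarith [Nat.cast_nonneg (α := ℝ) ⌊(r + 1) * M⌋₊]
  · have : r - ((⌊(r + 1) * M⌋₊ : ℝ) - M) / M = ((r + 1) * M - ⌊(r + 1) * M⌋₊) / M := by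
      field_simp; ring
    rw [this, abs_div, abs_of_pos hM0]
    gcongr
    rw [abs_le]; constructor <;> linarith

/-- The two-stage algorithm needs a number of function values that is linear in `d` and `1 / ε`. -/
theorem infoComplexity_holderRidgeClassDeriv_le {s : ℕ} {β κ ε : ℝ} (hβ : 0 < β) (hβ1 : β ≤ 1)
    (hs : 1 ≤ s) (hκ : 0 < κ) (hε : 0 < ε) (d : ℕ) :
    infoComplexity (holderRidgeClassDeriv s β κ) ε d ≤ (d + 1 + (2 * ⌈4 / ε⌉₊ + 1) : ℕ) := by
  set M := ⌈4 / ε⌉₊ with hM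
  have hM1 : 1 ≤ M := Nat.ceil_pos.2 (by positivity)
  have hM0 : (0 : ℝ) < M := by exact_mod_cast hM1
  have hMε : 1 / (M : ℝ) ≤ ε / 4 := by
    rw [div_le_iff₀ hM0]
    have := Nat.le_ceil (4 / ε)
    rw [div_le_iff₀ hε] at this
    linarith
  obtain ⟨h, hh, hsh, hω⟩ := exists_small_step s (1 / 2) hβ one_pos
    (show 0 < ε / 8 * κ by positivity)
  have hω' : 2 * (s * h) ^ β ≤ ε / 8 * κ := by linarith
  refine infoComplexity_le (by omega) (samplingNumber_le_of_information (twoStagePoint d M h)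
    ?_ ?_ ?_)
  · rintro f ⟨g, a, hg, ha, -, hf⟩
    exact continuous_ridge hg ha hf
  · intro f hf f' hf' hff x
    have hc := originDiff_eq_of_sampleValues_eq (by omega) hff
    obtain ⟨j, hj, hj1, hj2⟩ := exists_grid_point hM1
      (abs_inner_le_one (norm_unitDirection_le (originDiff h f)) (mem_closedBall_zero_iff.1 x.2))
    have h1 := abs_sub_apply_line_le hβ hβ1 hs hκ hh hsh hω' hf x hj1 hj2
    have h2 := hj2
    rw [hc] at h2
    replace h2 := abs_sub_apply_line_le hβ hβ1 hs hκ hh hsh hω' hf' x hj1 h2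
    have h3 := apply_point_eq_of_sampleValues_eq hff (k := d + 1 + j) (by omega)
    rw [twoStagePoint_sampleValues] at h3
    rw [← hc, ← h3] at h2
    rw [abs_le] at h1 h2 ⊢
    constructor <;> linarith [h1.1, h1.2, h2.1, h2.2]
  · intro f hf hf0 x
    obtain ⟨j, hj, hj1, hj2⟩ := exists_grid_point hM1
      (abs_inner_le_one (norm_unitDirection_le (originDiff h f)) (mem_closedBall_zero_iff.1 x.2))
    have h1 := abs_sub_apply_line_le hβ hβ1 hs hκ hh hsh hω' hf x hj1 hj2
    have h3 := apply_point_eq_of_sampleValues_eq (f' := fun _ => 0)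
      (hf0.trans (sampleValues_eq_zero _ _ _ fun _ _ => rfl).symm) (k := d + 1 + j) (by omega)
    rw [twoStagePoint_sampleValues] at h3
    rw [h3, sub_zero] at h1
    linarith

/-! ### Tractability -/

theorem exists_isHolderProfile_of_lt {α : ℝ≥0∞} (hα : 0 < α) {L : ℝ}
    (hLα : ENNReal.ofReal L < α) : ∃ (s : ℕ) (β : ℝ), 0 < β ∧ β ≤ 1 ∧ L < s + β ∧
      ∀ g, InProfileBall α g → IsHolderProfile s β g := by
  rcases eq_or_ne α ⊤ with rfl | htop
  · refine ⟨⌈L⌉₊, 1, one_pos, le_rfl, ?_, fun g hg => hg.isHolderProfile_of_top _⟩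
    linarith [Nat.le_ceil L]
  · have hpos : 0 < α.toReal := ENNReal.toReal_pos hα.ne' htop
    refine ⟨_, _, sub_pos.2 (strictFloor_lt hpos), sub_strictFloor_le_one _, ?_,
      fun g hg => hg.isHolderProfile_of_lt_top hα (lt_top_iff_ne_top.2 htop)⟩
    rw [add_sub_cancel]
    by_contra! hle
    have := ENNReal.ofReal_le_ofReal hle
    rw [ENNReal.ofReal_toReal htop] at this
    exact absurd hLα (not_lt.2 this)

theorem ridgeClass_subset_holderRidgeClass {α : ℝ≥0∞} {p β r : ℝ} {s : ℕ}
    (h : ∀ g, InProfileBall α g → IsHolderProfile s β g) (hp : 0 < p) (hpr : p ≤ r) (d : ℕ) :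
    ridgeClass α p d ⊆ holderRidgeClass s β r d := by
  rintro f ⟨g, a, hg, ha, hf⟩
  exact ⟨g, a, h g hg, sum_rpow_le_one_of_le hp hpr (sum_rpow_le_one_of_lpQuasiNorm_le hp ha), hf⟩

theorem ridgeClassDeriv_subset_holderRidgeClassDeriv {α : ℝ≥0∞} {p β κ : ℝ} {s : ℕ}
    (h : ∀ g, InProfileBall α g → IsHolderProfile s β g) (hp : 0 < p) (hp2 : p ≤ 2) (d : ℕ) :
    ridgeClassDeriv α p κ d ⊆ holderRidgeClassDeriv s β κ d := by
  rintro f ⟨g, a, hg, ha, hgκ, hf⟩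
  exact ⟨g, a, h g hg, norm_le_one_of_sum_rpow_le hp hp2
    (sum_rpow_le_one_of_lpQuasiNorm_le hp ha), hgκ, hf⟩

theorem infoComplexity_ridgeClass_le {α : ℝ≥0∞} {p β ε : ℝ} {s : ℕ} (hβ : 0 < β) (hβ1 : β ≤ 1)
    (h : ∀ g, InProfileBall α g → IsHolderProfile s β g) (hp0 : 0 < p) (hp2 : p < 2) (hε : 0 < ε)
    (hε1 : ε ≤ 1) (d : ℕ) : infoComplexity (ridgeClass α p) ε d ≤ ((2 * d + 1) ^
      (⌊(8 * 2 ^ (s + β) / ε) ^ (2 / ((2 / max 1 p - 1) * (s + β)))⌋₊ + s) : ℕ) := by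
  refine (infoComplexity_mono (ridgeClass_subset_holderRidgeClass h hp0 (le_max_right 1 p) d)
    ε).trans ((infoComplexity_holderRidgeClass_le hβ hβ1 (le_max_left 1 p)
      (max_lt (by norm_num) hp2) hε hε1 d).trans ?_)
  rw [Nat.cast_le, pow_add]
  exact Nat.mul_le_mul_left _ (Nat.pow_le_pow_left (by omega) s)

theorem toENNReal_le_ofReal {N : ℕ∞} {n : ℕ} {x : ℝ} (h : N ≤ n) (hx : (n : ℝ) ≤ x) :
    (N : ℝ≥0∞) ≤ ENNReal.ofReal x := by
  calc (N : ℝ≥0∞) ≤ ((n : ℕ∞) : ℝ≥0∞) := ENat.toENNReal_le.2 h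
    _ = ENNReal.ofReal n := by simp
    _ ≤ _ := ENNReal.ofReal_le_ofReal hx

theorem curseOfDimensionality_ridgeClass {α : ℝ≥0∞} (hα : 0 < α) (hα' : α < ⊤) :
    CurseOfDimensionality (infoComplexity (ridgeClass α 2)) := by
  obtain ⟨c, hc, hc1, h⟩ := exists_le_infoComplexity_ridgeClass hα hα' two_pos le_rfl
  refine ⟨1, c / 2, 1 / 10, one_pos, by positivity, by linarith, by norm_num, fun ε _ hε => ?_⟩
  rw [frequently_atTop]
  intro n
  refine ⟨4 * (n + 1), by omega, le_trans ?_ (h (n + 1) (by omega) ε ?_)⟩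
  · refine ENNReal.ofReal_le_ofReal ?_
    rw [one_mul, pow_mul]
    gcongr
    norm_num
  · norm_num
    linarith

theorem not_curseOfDimensionality_ridgeClass {α : ℝ≥0∞} {p : ℝ} (hα : 0 < α) (hp0 : 0 < p)
    (hp2 : p < 2) : ¬ CurseOfDimensionality (infoComplexity (ridgeClass α p)) := by
  rintro ⟨c, ε, γ, hc, hε, hε1, hγ, h⟩
  obtain ⟨s, β, hβ, hβ1, -, hprof⟩ := exists_isHolderProfile_of_lt (L := 0) hα (by simpa using hα)
  obtain ⟨n, hn⟩ : ∃ n : ℕ, ∀ d : ℕ,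
      infoComplexity (ridgeClass α p) ε d ≤ ((2 * d + 1) ^ n : ℕ) :=
    ⟨_, fun d => infoComplexity_ridgeClass_le hβ hβ1 hprof hp0 hp2 hε hε1 d⟩
  have hlim := tendsto_pow_const_div_const_pow_of_one_lt n (show 1 < 1 + γ by linarith)
  have hev : ∀ᶠ d : ℕ in atTop, ((2 * d + 1) ^ n : ℕ) < c * (1 + γ) ^ d := by
    filter_upwards [hlim.eventually (gt_mem_nhds (show 0 < c / 3 ^ n by positivity)),
      eventually_ge_atTop 1] with d hd hd1
    have hd1' : (1 : ℝ) ≤ d := by exact_mod_cast hd1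
    rw [div_lt_div_iff₀ (by positivity) (by positivity), ← mul_pow] at hd
    push_cast
    refine lt_of_le_of_lt ?_ hd
    gcongr
    linarith
  obtain ⟨d, hd, hd'⟩ := ((h ε hε le_rfl).and_eventually hev).exists
  have h1 : (infoComplexity (ridgeClass α p) ε d : ℝ≥0∞) ≤
      ENNReal.ofReal ((2 * d + 1) ^ n : ℕ) := toENNReal_le_ofReal (hn d) le_rfl
  exact absurd (hd.trans h1) (not_le.2 ((ENNReal.ofReal_lt_ofReal_iff (by positivity)).2 hd'))

theorem intractable_ridgeClass {α : ℝ≥0∞} {p : ℝ} (hα : 0 < α) (hp0 : 0 < p) (hp2 : p < 2)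
    (hαp : α ≤ ENNReal.ofReal (1 / (1 / p - 1 / 2))) :
    Intractable (infoComplexity (ridgeClass α p)) := by
  intro hweak
  have hα' : α < ⊤ := hαp.trans_lt ENNReal.ofReal_lt_top
  have hσ : 0 < 1 / p - 1 / 2 := sub_pos.2 (one_div_lt_one_div_of_lt hp0 hp2)
  have hA : (1 / p - 1 / 2) * α.toReal ≤ 1 := by
    have := ENNReal.toReal_mono ENNReal.ofReal_ne_top hαp
    rw [ENNReal.toReal_ofReal (by positivity), le_div_iff₀ hσ] at this
    linarith
  obtain ⟨c, hc, hc1, h⟩ := exists_le_infoComplexity_ridgeClass hα hα' hp0 hp2.le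
  -- The smoothness is so small that the bumps in dimension `d` have height at least `c / d`.
  -- Half of this bound is still of order `1 / d`, hence `1 / ε + d` is linear in `d`.
  let z : ℕ → ℝ × ℕ := fun k => (c / (2 * (4 * (k + 1) : ℕ)), 4 * (k + 1))
  have hzsum : ∀ k, 1 / (z k).1 + ((z k).2 : ℝ) = (8 / c + 4) * (k + 1) := fun k => by
    simp only [z]; push_cast; field_simp; ring
  have hz : Tendsto z atTop (comap (fun z : ℝ × ℕ => 1 / z.1 + (z.2 : ℝ)) atTop ⊓
      𝓟 {z : ℝ × ℕ | 0 < z.1 ∧ z.1 ≤ 1 ∧ 1 ≤ z.2}) := by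
    refine tendsto_inf.2 ⟨tendsto_comap_iff.2 ?_, tendsto_principal.2 (Eventually.of_forall
      fun k => ⟨?_, ?_, ?_⟩)⟩
    · have : (fun z : ℝ × ℕ => 1 / z.1 + (z.2 : ℝ)) ∘ z =
          fun k : ℕ => (8 / c + 4) * ((k : ℝ) + 1) := funext hzsum
      rw [this]
      exact (tendsto_atTop_add_const_right _ 1 tendsto_natCast_atTop_atTop).const_mul_atTop
        (by positivity)
    · simp only [z]; positivity
    · simp only [z]
      rw [div_le_one (by positivity)]
      push_cast
      nlinarith [Nat.cast_nonneg (α := ℝ) k]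
    · simp only [z]; omega
  have hlog : 0 < Real.log (27 / 16) := Real.log_pos (by norm_num)
  set q : ℝ := Real.log (27 / 16) / (8 / c + 4) with hq
  have hq0 : 0 < q := by positivity
  obtain ⟨k, hk⟩ := ((hweak.comp hz).eventually
    (gt_mem_nhds (show (0 : EReal) < (q : EReal) by exact_mod_cast hq0))).exists
  refine absurd hk (not_lt.2 ?_)
  have h1 := h (k + 1) (by omega) (c / (2 * (4 * (k + 1) : ℕ))) (by
    have hd0 : (0 : ℝ) < (4 * (k + 1) : ℕ) := by positivity
    have hd1 : (1 : ℝ) ≤ (4 * (k + 1) : ℕ) := by exact_mod_cast (by omega : 1 ≤ 4 * (k + 1))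
    have h2 : ((4 * (k + 1) : ℕ) : ℝ) ^ (-1 : ℝ) ≤
        ((4 * (k + 1) : ℕ) : ℝ) ^ ((1 / 2 - 1 / p) * α.toReal) :=
      Real.rpow_le_rpow_of_exponent_le hd1 (by linarith)
    rw [Real.rpow_neg_one] at h2
    have h3 : c / (2 * (4 * (k + 1) : ℕ)) < c * ((4 * (k + 1) : ℕ) : ℝ)⁻¹ := by
      rw [← div_eq_mul_inv]
      exact div_lt_div_of_pos_left hc hd0 (by linarith)
    exact h3.trans_le (by gcongr))
  have h2 := ENNReal.log_le_log h1
  rw [ENNReal.log_ofReal_of_pos (by positivity), Real.log_pow] at h2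
  simp only [Function.comp_apply]
  rw [hzsum k]
  refine le_trans (le_of_eq ?_) (EReal.div_le_div_right_of_nonneg
    (EReal.coe_nonneg.2 (by positivity)) h2)
  rw [← EReal.coe_div, hq]
  congr 1
  push_cast
  field_simp

/-- A bound `(2d + 1) ^ (B ε ^ (-θ) + s)` with `θ < 1` implies weak tractability. -/
theorem weaklyTractable_of_le {N : ℝ → ℕ → ℕ∞} {B θ : ℝ} (s : ℕ) (hB : 0 ≤ B) (hθ : 0 < θ)
    (hθ1 : θ < 1) (hN1 : ∀ ε d, 1 ≤ N ε d)
    (hN : ∀ ε : ℝ, 0 < ε → ε ≤ 1 → ∀ d : ℕ,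
      N ε d ≤ ((2 * d + 1) ^ (⌊B * (1 / ε) ^ θ⌋₊ + s) : ℕ)) : WeaklyTractable N := by
  set ρ := (1 - θ) / 2 with hρ
  have hρ0 : 0 < ρ := by rw [hρ]; linarith
  set K : ℝ := (B + s) * (3 ^ ρ / ρ) with hK
  have hlim : Tendsto (fun x : ℝ => K * x ^ (-ρ)) atTop (𝓝 0) := by
    simpa using (tendsto_rpow_neg_atTop hρ0).const_mul K
  have hlim' : Tendsto (fun z : ℝ × ℕ => ((K * (1 / z.1 + (z.2 : ℝ)) ^ (-ρ) : ℝ) : EReal))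
      (comap (fun z : ℝ × ℕ => 1 / z.1 + (z.2 : ℝ)) atTop ⊓
        𝓟 {z : ℝ × ℕ | 0 < z.1 ∧ z.1 ≤ 1 ∧ 1 ≤ z.2}) (𝓝 0) :=
    (continuous_coe_real_ereal.tendsto' _ _ EReal.coe_zero).comp
      (hlim.comp (tendsto_comap.mono_left inf_le_left))
  have hmem : ∀ᶠ z : ℝ × ℕ in comap (fun z : ℝ × ℕ => 1 / z.1 + (z.2 : ℝ)) atTop ⊓
      𝓟 {z : ℝ × ℕ | 0 < z.1 ∧ z.1 ≤ 1 ∧ 1 ≤ z.2}, 0 < z.1 ∧ z.1 ≤ 1 ∧ 1 ≤ z.2 :=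
    mem_inf_of_right (mem_principal_self _)
  refine tendsto_of_tendsto_of_tendsto_of_le_of_le' tendsto_const_nhds hlim' ?_ ?_
  · filter_upwards [hmem] with z hz
    obtain ⟨hε, -, -⟩ := hz
    refine EReal.div_nonneg ?_ (EReal.coe_nonneg.2 (by positivity))
    rw [← ENNReal.log_one]
    exact ENNReal.log_le_log (by exact_mod_cast hN1 z.1 z.2)
  · filter_upwards [hmem] with z hz
    obtain ⟨ε, d⟩ := z
    obtain ⟨hε, hε1, hd⟩ := hz
    simp only at hε hε1 hd ⊢
    have hd1 : (1 : ℝ) ≤ d := by exact_mod_cast hd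
    have hε' : 1 ≤ 1 / ε := by rw [le_div_iff₀ hε]; linarith
    set x : ℝ := 1 / ε + d with hx
    have hx1 : 1 ≤ x := by linarith
    have hx0 : 0 < x := by linarith
    have h1 : ENNReal.log (N ε d : ℝ≥0∞) ≤
        (((⌊B * (1 / ε) ^ θ⌋₊ + s : ℕ) * Real.log (2 * d + 1) : ℝ) : EReal) := by
      have h2 := ENNReal.log_le_log (toENNReal_le_ofReal (hN ε hε hε1 d) le_rfl)
      rw [ENNReal.log_ofReal_of_pos (by positivity)] at h2
      push_cast at h2
      rw [Real.log_pow] at h2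
      exact_mod_cast h2
    refine (EReal.div_le_div_right_of_nonneg (EReal.coe_nonneg.2 hx0.le) h1).trans ?_
    rw [← EReal.coe_div, EReal.coe_le_coe_iff, div_le_iff₀ hx0]
    have h3 : ((⌊B * (1 / ε) ^ θ⌋₊ + s : ℕ) : ℝ) ≤ (B + s) * x ^ θ := by
      push_cast
      have h4 : (⌊B * (1 / ε) ^ θ⌋₊ : ℝ) ≤ B * x ^ θ :=
        (Nat.floor_le (by positivity)).trans (by gcongr; linarith)
      have h5 : (1 : ℝ) ≤ x ^ θ := Real.one_le_rpow hx1 hθ.le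
      nlinarith [Nat.cast_nonneg (α := ℝ) s]
    have h6 : Real.log (2 * d + 1) ≤ 3 ^ ρ / ρ * x ^ ρ := by
      calc Real.log (2 * d + 1) ≤ Real.log (3 * x) :=
            Real.log_le_log (by positivity) (by linarith)
        _ ≤ (3 * x) ^ ρ / ρ := Real.log_le_rpow_div (by positivity) hρ0
        _ = _ := by rw [Real.mul_rpow (by norm_num) hx0.le]; ring
    calc _ ≤ ((B + s) * x ^ θ) * (3 ^ ρ / ρ * x ^ ρ) :=
          mul_le_mul h3 h6 (Real.log_nonneg (by linarith)) (by positivity)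
      _ = K * (x ^ θ * x ^ ρ) := by rw [hK]; ring
      _ = K * x ^ (-ρ) * x := by
          have : x ^ (-ρ) * x = x ^ θ * x ^ ρ := by
            rw [← Real.rpow_add hx0]
            nth_rewrite 2 [← Real.rpow_one x]
            rw [← Real.rpow_add hx0, hρ]
            ring_nf
          rw [mul_assoc K, this]

theorem weaklyTractable_ridgeClass {α : ℝ≥0∞} {p : ℝ} (hα : 0 < α) (hp0 : 0 < p) (hp2 : p < 2)
    (hαp : ENNReal.ofReal (1 / (1 / max 1 p - 1 / 2)) < α) :
    WeaklyTractable (infoComplexity (ridgeClass α p)) := by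
  obtain ⟨s, β, hβ, hβ1, hL, hprof⟩ := exists_isHolderProfile_of_lt hα hαp
  set r := max 1 p with hr
  have hr1 : 1 ≤ r := le_max_left 1 p
  have hr2 : r < 2 := max_lt (by norm_num) hp2
  have hσ : 0 < 1 / r - 1 / 2 := sub_pos.2 (one_div_lt_one_div_of_lt (by linarith) hr2)
  have hA : 0 < s + β := by positivity
  have hθ : 2 / ((2 / r - 1) * (s + β)) < 1 := by
    have h1 : 2 / r - 1 = 2 * (1 / r - 1 / 2) := by ring
    rw [div_lt_iff₀ hσ] at hL
    rw [h1, div_lt_one (by positivity)]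
    nlinarith
  have hσ' : 0 < 2 / r - 1 := by
    have h1 : 2 / r - 1 = 2 * (1 / r - 1 / 2) := by ring
    rw [h1]; positivity
  refine weaklyTractable_of_le (B := (8 * 2 ^ (s + β)) ^ (2 / ((2 / r - 1) * (s + β)))) s
    (by positivity) (by positivity) hθ (one_le_infoComplexity _) fun ε hε hε1 d => ?_
  rw [← Real.mul_rpow (by positivity) (by positivity), mul_one_div]
  exact infoComplexity_ridgeClass_le hβ hβ1 hprof hp0 hp2 hε hε1 d

theorem quasiPolynomiallyTractable_ridgeClass {p : ℝ} (hp0 : 0 < p) (hp2 : p ≤ 2) :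
    QuasiPolynomiallyTractable (infoComplexity (ridgeClass ⊤ p)) := by
  refine ⟨1, 5, one_pos, by norm_num, fun ε hε hε1 d hd => ?_⟩
  set L := Real.log (1 / ε) with hLdef
  have hL : 0 ≤ L := Real.log_nonneg (by rw [le_div_iff₀ hε]; linarith)
  have hlog2 : 1 / 2 < Real.log 2 := by linarith [Real.log_two_gt_d9]
  -- This order makes the Taylor remainder `4 / s!` smaller than `ε`, since `2 ^ (s - 1) ≤ s!`.
  set n := ⌈L / Real.log 2⌉₊ with hn
  have hfact : ∀ m : ℕ, 2 ^ m ≤ (m + 1).factorial := fun m => by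
    induction m with
    | zero => simp
    | succ m ih =>
      rw [Nat.factorial_succ, pow_succ, mul_comm]
      exact Nat.mul_le_mul (by omega) ih
  have hpow : 1 / ε ≤ 2 ^ n := by
    have h1 : L ≤ n * Real.log 2 := by
      rw [← div_le_iff₀ (by linarith)]; exact Nat.le_ceil _
    rw [← Real.log_pow] at h1
    exact (Real.log_le_log_iff (by positivity) (by positivity)).1 h1
  have hs : 4 / ((n + 4).factorial : ℝ) < ε := by
    have h1 : (2 : ℝ) ^ (n + 3) ≤ (n + 4).factorial := by exact_mod_cast hfact (n + 3)
    rw [pow_add] at h1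
    rw [div_le_iff₀ hε] at hpow
    rw [div_lt_iff₀ (by positivity)]
    nlinarith
  have h1 := (infoComplexity_mono (ridgeClass_subset_holderRidgeClass
    (fun g hg => hg.isHolderProfile_of_top (n + 4)) hp0 hp2 d) ε).trans
    (infoComplexity_holderRidgeClass_le_of_factorial one_pos le_rfl two_pos le_rfl hs d)
  refine toENNReal_le_ofReal h1 ?_
  have hd1 : (1 : ℝ) ≤ d := by exact_mod_cast hd
  have hlogd : 0 ≤ Real.log d := Real.log_nonneg hd1
  have hbase : (d + 1 : ℝ) ≤ Real.exp (1 + Real.log d) := by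
    rw [Real.exp_add, Real.exp_log (by linarith)]
    nlinarith [Real.add_one_le_exp (1 : ℝ)]
  have hsn : ((n + 4 : ℕ) : ℝ) ≤ 5 * (1 + L) := by
    have h2 := Nat.ceil_lt_add_one (a := L / Real.log 2) (by positivity)
    have h3 : L / Real.log 2 ≤ 2 * L := by
      rw [div_le_iff₀ (by linarith)]; nlinarith
    push_cast
    linarith
  push_cast
  rw [one_mul]
  calc (d + 1 : ℝ) ^ (n + 4) ≤ Real.exp (1 + Real.log d) ^ (n + 4) := by gcongr
    _ = Real.exp ((n + 4 : ℕ) * (1 + Real.log d)) := by rw [Real.exp_nat_mul]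
    _ ≤ _ := by gcongr

theorem polynomiallyTractable_ridgeClassDeriv {α : ℝ≥0∞} {p κ : ℝ} (hα : 1 < α) (hp0 : 0 < p)
    (hp2 : p ≤ 2) (hκ : 0 < κ) :
    PolynomiallyTractable (infoComplexity (ridgeClassDeriv α p κ)) := by
  obtain ⟨s, β, hβ, hβ1, hL, hprof⟩ := exists_isHolderProfile_of_lt (L := 1)
    (zero_lt_one.trans hα) (by simpa using hα)
  have hs : 1 ≤ s := by
    have : (0 : ℝ) < s := by linarith
    exact_mod_cast this
  refine ⟨13, 1, 1, by norm_num, one_pos, one_pos, fun ε hε hε1 d hd => ?_⟩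
  refine toENNReal_le_ofReal ((infoComplexity_mono
    (ridgeClassDeriv_subset_holderRidgeClassDeriv hprof hp0 hp2 d) ε).trans
    (infoComplexity_holderRidgeClassDeriv_le hβ hβ1 hs hκ hε d)) ?_
  have hd1 : (1 : ℝ) ≤ d := by exact_mod_cast hd
  have h1 := Nat.ceil_lt_add_one (a := 4 / ε) (by positivity)
  have h2 : 1 ≤ ε⁻¹ := (one_le_inv₀ hε).2 hε1.le
  rw [Real.rpow_neg_one, Real.rpow_one]
  rw [div_eq_mul_inv] at h1 ⊢
  push_cast
  nlinarith [mul_nonneg (sub_nonneg.2 h2) (sub_nonneg.2 hd1)]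

theorem mainTheorem4 (α : ℝ≥0∞) (p : ℝ) (hα : 0 < α) (hp0 : 0 < p) (hp2 : p ≤ 2) :
    (p = 2 → α < ⊤ → CurseOfDimensionality (infoComplexity (ridgeClass α p))) ∧
    (p < 2 → ¬ CurseOfDimensionality (infoComplexity (ridgeClass α p))) ∧
    (p < 2 → α ≤ ENNReal.ofReal (1 / (1 / p - 1 / 2)) →
      Intractable (infoComplexity (ridgeClass α p))) ∧
    (p < 2 → ENNReal.ofReal (1 / (1 / max 1 p - 1 / 2)) < α →
      WeaklyTractable (infoComplexity (ridgeClass α p))) ∧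
    (α = ⊤ → QuasiPolynomiallyTractable (infoComplexity (ridgeClass α p))) ∧
    (1 < α → ∀ κ : ℝ, 0 < κ →
      PolynomiallyTractable (infoComplexity (ridgeClassDeriv α p κ))) := by
  refine ⟨?_, not_curseOfDimensionality_ridgeClass hα hp0, intractable_ridgeClass hα hp0,
    weaklyTractable_ridgeClass hα hp0, ?_,
    fun hα1 κ hκ => polynomiallyTractable_ridgeClassDeriv hα1 hp0 hp2 hκ⟩
  · rintro rfl hα'
    exact curseOfDimensionality_ridgeClass hα hα'
  · rintro rfl
    exact quasiPolynomiallyTractable_ridgeClass hp0 hp2
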